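/- Let $b\ge 2$ be an integer and $\omega_b=e^{2\pi\sqrt{-1}/b}$. Let $\alpha$ and $k$ be positive integers, and write $k=\kappa_1b^{a_1-1}+\dots+\kappa_vb^{a_v-1}$ with integers $1\le\kappa_i\le b-1$ and $a_1>\dots>a_v\ge1$, so that $v\ge 1$ is the number of nonzero $b$-adic digits of $k$. The $b$-adic $k$-th Walsh function is $\mathrm{wal}_k(x)=\omega_b^{\sum_{i=1}^v\kappa_i\xi_{a_i}}$ for $x=\xi_1b^{-1}+\xi_2b^{-2}+\cdots\in[0,1)$ (digit expansion with infinitely many digits different from $b-1$), and $\widehat f(k)=\int_0^1 f(x)\overline{\mathrm{wal}_k(x)}\,dx$. For $i\ge1$ put $$\mu_{i,\mathrm{per}}(k)=\begin{cases}a_1+\dots+a_v+(i-v)a_v & \text{if } v\le i,\\ a_1+\dots+a_i & \text{if } v\ge i.\end{cases}$$ Put $m_b=\min_{1\le c\le b-1}|1-\omega_b^{-c}|$ and $M_b=\max_{1\le c\le b-1}|1-\omega_b^{-c}|$, and for $b>2$ put $$C_{b,v}=\frac{b\,m_b}{b-M_b}\left(1-\left(\frac{M_b}{b}\right)^{v}\right).$$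 **Theorem.** Let $f\colon[0,1]\to\mathbb R$ belong to the unanchored Sobolev space $\mathcal H_\alpha$, i.e. $f^{(i)}$ exists and is absolutely continuous on $[0,1]$ for $i=0,\dots,\alpha-1$, and $f^{(\alpha)}\in L^2[0,1]$. If $b>2$, then $$|\widehat f(k)|\le\sum_{i=v}^{\alpha}\left|\int_0^1f^{(i)}(x)\,dx\right|\frac{b^{-\mu_{i,\mathrm{per}}(k)}}{m_b^{i}}\,(1+C_{b,v})+\int_0^1|f^{(\alpha)}(x)|\,dx\;\frac{b^{-\mu_{\alpha,\mathrm{per}}(k)}}{m_b^{\alpha}}\,(M_b+C_{b,v}),$$ and if $b=2$, then $$|\widehat f(k)|\le\sum_{\substack{v\le i\le\alpha\\ i\equiv v\ (\mathrm{mod}\ 2)}}\left|\int_0^1f^{(i)}(x)\,dx\right|\frac{2^{-\mu_{i,\mathrm{per}}(k)}}{2^{i}}+\int_0^1|f^{(\alpha)}(x)|\,dx\;\frac{2^{-\mu_{\alpha,\mathrm{per}}(k)}}{2^{\alpha-1}}.$$ For $v>\alpha$ the sums over $i$ are empty and equal to $0$. -/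

import Mathlib

/-- The digit of `k` in base `b` that stands in front of `b ^ (a - 1)`, for `a ≥ 1`. -/
def walshDigit (b k a : ℕ) : ℕ := (Nat.digits b k).getD (a - 1) 0

/-- The positions `a ≥ 1` of the nonzero `b`-adic digits of `k`, i.e. the set `{a_1, ..., a_v}`
where `k = κ_1 b ^ (a_1 - 1) + ... + κ_v b ^ (a_v - 1)` with all `κ_i ≠ 0`. -/
def walshPositions (b k : ℕ) : Finset ℕ :=
  {a ∈ Finset.Icc 1 (Nat.digits b k).length | walshDigit b k a ≠ 0}

/-- The Hamming weight `v` of `k`: its number of nonzero `b`-adic digits. -/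
def walshWeight (b k : ℕ) : ℕ := (walshPositions b k).card

/-- `a_i` for `1 ≤ i ≤ v`, where `a_1 > ... > a_v`. -/
def walshPos (b k i : ℕ) : ℕ := ((walshPositions b k).sort (· ≥ ·)).getD (i - 1) 0

/-- The `b`-adic `k`-th Walsh function on `[0, 1)`. The digit `ξ_a` of `x = ∑ ξ_a b ^ (-a)` is
`Real.digits x b (a - 1) = ⌊x * b ^ a⌋ mod b`, the digit expansion in which infinitely many digits
are different from `b - 1`. -/
noncomputable def walsh (b : ℕ) [NeZero b] (k : ℕ) (x : ℝ) : ℂ :=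
  Complex.exp (2 * Real.pi * Complex.I / b) ^
    (∑ a ∈ walshPositions b k, walshDigit b k a * (Real.digits x b (a - 1) : ℕ))

/-- The `k`-th `b`-adic Walsh coefficient of `f : [0, 1) → ℝ`. -/
noncomputable def walshCoeff (b : ℕ) [NeZero b] (f : ℝ → ℝ) (k : ℕ) : ℂ :=
  ∫ x in Set.Ico (0 : ℝ) 1, (f x : ℂ) * starRingEnd ℂ (walsh b k x)

/-- `μ_{α, per}(k)`. -/
def muPer (b α k : ℕ) : ℕ :=
  if k = 0 then 0
  else if walshWeight b k ≤ α then
    ∑ i ∈ Finset.Icc 1 (walshWeight b k), walshPos b k i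
      + (α - walshWeight b k) * walshPos b k (walshWeight b k)
  else ∑ i ∈ Finset.Icc 1 α, walshPos b k i

/-- The numbers `|1 - ω ^ (-c)|` for `c = 1, ..., b - 1`, where `ω = exp (2 π i / b)`. -/
noncomputable def rootDistances (b : ℕ) : Set ℝ :=
  (fun c : ℕ => ‖1 - starRingEnd ℂ (Complex.exp (2 * Real.pi * Complex.I / b)) ^ c‖) ''
    Set.Icc 1 (b - 1)

/-- `m_b = min_{1 ≤ c ≤ b - 1} |1 - ω ^ (-c)|` (a finite nonempty set of numbers for `b ≥ 2`). -/
noncomputable def mMin (b : ℕ) : ℝ := sInf (rootDistances b)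

/-- `M_b = max_{1 ≤ c ≤ b - 1} |1 - ω ^ (-c)|` (a finite nonempty set of numbers for `b ≥ 2`). -/
noncomputable def mMax (b : ℕ) : ℝ := sSup (rootDistances b)

/-- The constant `b m_b / (b - M_b) * (1 - (M_b / b) ^ v)`. -/
noncomputable def walshConst (b v : ℕ) : ℝ :=
  b * mMin b / (b - mMax b) * (1 - (mMax b / b) ^ v)

/-- The `i`-th derivative of `f : [0, 1] → ℝ` (one-sided at the end points). -/
noncomputable def derivUnit (i : ℕ) (f : ℝ → ℝ) : ℝ → ℝ :=
  iteratedDerivWithin i f (Set.Icc 0 1)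

/-- The unanchored Sobolev space of order `α`: the functions `f` on `[0, 1]` (values outside
`[0, 1]` play no role) whose derivatives of order `< α` exist and are absolutely continuous on
`[0, 1]`, and whose `α`-th derivative, which then exists almost everywhere, is in `L²[0, 1]`. -/
structure MemSobolevUnit (α : ℕ) (f : ℝ → ℝ) : Prop where
  differentiableOn : ∀ i, i + 1 < α → DifferentiableOn ℝ (derivUnit i f) (Set.Icc 0 1)
  absolutelyContinuous : ∀ i < α, AbsolutelyContinuousOnInterval (derivUnit i f) 0 1
  memLp : MeasureTheory.MemLp (derivUnit α f) 2
    (MeasureTheory.volume.restrict (Set.Icc (0 : ℝ) 1))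

/-!
A quasi-periodic function `g (x + L) = z g x` with `z ≠ 1` has exactly one primitive with the same
quasi-periodicity, `(z - 1)⁻¹ ∫ t in x..x + L, g t`. The conjugate Walsh function is a product of
step characters `z_i ^ ⌊x / L_i⌋` with `L_i = b ^ (-a_i)` and `z_i = ω ^ (-κ_i)`, and it is
quasi-periodic for the last pair `(L_v, z_v)`. Integrating by parts `α` times against its iterated
quasi-periodic primitives `ψ_i`, which are `1`-periodic, gives
`f̂(k) = ∑ i, ± ψ_i(0) ∫ f^(i) ± ∫ f^(α) ψ_α`.

Primitives can be taken one character at a time: the iterated integral `∫₀ˣ` of the first `n`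
characters vanishes at the multiples of all later lengths, so the remaining characters, which are
constant in between, pass through the integral. Hence `ψ_i(0) = 0` for `1 ≤ i < v`. The iterated
integral has mean `∏ L_i / (1 - z_i)`, and its oscillating part shrinks by the factor `M_b / b` with
each further integration, since lengths grow at least by a factor `b`. As `M_b / b ≤ m_b`, which
follows from `M_b ≤ 2 ≤ b m_b`, the resulting geometric series is absorbed into `C_{b,v}`. Each
primitive beyond the `v`-th costs a factor `b ^ (-a_v) / m_b`.

For `b = 2` all characters are real with factor `-1`. The iterated integrals are then nonnegative,
so the integrals of their absolute values over a period are their exact means, and `ψ_v, ψ_{v+1},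
…` are alternately even and odd, which removes the terms with `i ≢ v` modulo `2`.
-/

open MeasureTheory

section Primitive

variable {E : Type*} [NormedAddCommGroup E] [NormedSpace ℝ E]

/-- `G` is a primitive, in the integral sense, of the locally integrable function `g`. -/
structure IsPrimitive (G g : ℝ → E) : Prop where
  integrable : ∀ x y, IntervalIntegrable g volume x y
  integral : ∀ x y, ∫ t in x..y, g t = G y - G x

lemma isPrimitive_integral {g : ℝ → E} (hg : ∀ x y, IntervalIntegrable g volume x y) :
    IsPrimitive (fun x => ∫ t in (0 : ℝ)..x, g t) g :=
  ⟨hg, fun x y => (intervalIntegral.integral_interval_sub_left (hg 0 y) (hg 0 x)).symm⟩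

namespace IsPrimitive

variable {G g : ℝ → E}

lemma eq_add_integral (h : IsPrimitive G g) (x : ℝ) : G x = G 0 + ∫ t in (0 : ℝ)..x, g t := by
  rw [h.integral, add_sub_cancel]

lemma continuous (h : IsPrimitive G g) : Continuous G := by
  rw [funext h.eq_add_integral]
  exact continuous_const.add (intervalIntegral.continuous_primitive h.integrable 0)

lemma add_const (h : IsPrimitive G g) (c : E) : IsPrimitive (fun x => G x + c) g :=
  ⟨h.integrable, fun x y => by rw [h.integral, add_sub_add_right_eq_sub]⟩

lemma clm_comp [CompleteSpace E] {F : Type*} [NormedAddCommGroup F] [NormedSpace ℝ F]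
    [CompleteSpace F] (h : IsPrimitive G g) (φ : E →L[ℝ] F) :
    IsPrimitive (fun x => φ (G x)) (fun x => φ (g x)) :=
  ⟨fun x y => ⟨φ.integrable_comp (h.integrable x y).1, φ.integrable_comp (h.integrable x y).2⟩,
    fun x y => by rw [φ.intervalIntegral_comp_comm (h.integrable x y), h.integral, map_sub]⟩

end IsPrimitive

end Primitive

section QuasiPeriodic

variable {𝕜 : Type*} [RCLike 𝕜] {L B C : ℝ} {z : 𝕜} {G g : ℝ → 𝕜}

/-- `g` is quasi-periodic: translation by `L` multiplies it by `z`. -/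
def IsQuasiPeriodic (L : ℝ) (z : 𝕜) (g : ℝ → 𝕜) : Prop := ∀ x, g (x + L) = z * g x

/-- The quasi-periodic primitive of a quasi-periodic function `g` with factor `z ≠ 1`. -/
noncomputable def quasiPrim (L : ℝ) (z : 𝕜) (g : ℝ → 𝕜) (x : ℝ) : 𝕜 :=
  (z - 1)⁻¹ * ∫ t in x..x + L, g t

lemma norm_quasiPrim_le (hL : 0 ≤ L) (hg : ∀ x, ‖g x‖ ≤ C) (x : ℝ) :
    ‖quasiPrim L z g x‖ ≤ L / ‖1 - z‖ * C := by
  have h := intervalIntegral.norm_integral_le_of_norm_le_const (a := x) (b := x + L) fun t _ => hg t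
  rw [add_sub_cancel_left, abs_of_nonneg hL] at h
  calc ‖quasiPrim L z g x‖ = ‖1 - z‖⁻¹ * ‖∫ t in x..x + L, g t‖ := by
        rw [quasiPrim, norm_mul, norm_inv, norm_sub_rev]
    _ ≤ ‖1 - z‖⁻¹ * (C * L) := by gcongr
    _ = L / ‖1 - z‖ * C := by ring

namespace IsQuasiPeriodic

lemma nat_mul (hg : IsQuasiPeriodic L z g) (n : ℕ) : IsQuasiPeriodic (n * L) (z ^ n) g := by
  intro x
  induction n with
  | zero => simp
  | succ n ih => rw [Nat.cast_succ, add_one_mul, ← add_assoc, hg, ih, pow_succ', mul_assoc]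

lemma int_mul (hg : IsQuasiPeriodic L z g) (hz : z ≠ 0) (c : ℤ) :
    IsQuasiPeriodic (c * L) (z ^ c) g := by
  intro x
  obtain ⟨n, rfl | rfl⟩ := c.eq_nat_or_neg
  · exact_mod_cast hg.nat_mul n x
  · have h := hg.nat_mul n (x + (-n : ℤ) * L)
    rw [Int.cast_neg, Int.cast_natCast, neg_mul, neg_add_cancel_right] at h
    rw [Int.cast_neg, Int.cast_natCast, neg_mul, zpow_neg, zpow_natCast, h,
      inv_mul_cancel_left₀ (pow_ne_zero n hz)]

lemma periodic_nat_mul (hg : IsQuasiPeriodic L z g) {q : ℕ} (hq : z ^ q = 1) :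
    Function.Periodic g (q * L) := fun x => by
  rw [hg.nat_mul q, hq, one_mul]

lemma mul_periodic {p : ℝ → 𝕜} (hg : IsQuasiPeriodic L z g) (hp : Function.Periodic p L) :
    IsQuasiPeriodic L z (fun x => p x * g x) := fun x => by
  simp only [hp x, hg x, mul_left_comm]

lemma integral_add (hg : IsQuasiPeriodic L z g) (x y : ℝ) :
    ∫ t in x + L..y + L, g t = z * ∫ t in x..y, g t := by
  rw [← intervalIntegral.integral_comp_add_right, ← intervalIntegral.integral_const_mul]
  exact intervalIntegral.integral_congr fun t _ => hg t

lemma isQuasiPeriodic_quasiPrim (hg : IsQuasiPeriodic L z g) :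
    IsQuasiPeriodic L z (quasiPrim L z g) := fun x => by
  rw [quasiPrim, quasiPrim, hg.integral_add, mul_left_comm]

lemma isPrimitive_quasiPrim (hg : IsQuasiPeriodic L z g) (hz : z ≠ 1)
    (hint : ∀ x y, IntervalIntegrable g volume x y) : IsPrimitive (quasiPrim L z g) g := by
  refine ⟨hint, fun x y => ?_⟩
  have h : (∫ t in y..y + L, g t) - ∫ t in x..x + L, g t = (z - 1) * ∫ t in x..y, g t := by
    rw [sub_one_mul, ← hg.integral_add, intervalIntegral.integral_interval_sub_interval_comm'
      (hint _ _) (hint _ _) (hint _ _)]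
  rw [quasiPrim, quasiPrim, ← mul_sub, h, inv_mul_cancel_left₀ (sub_ne_zero.mpr hz)]

lemma quasiPrim_neg (hg : IsQuasiPeriodic L (-1) g) {ε : 𝕜} (hε : ∀ᵐ x, g (-x) = ε * g x) (x : ℝ) :
    quasiPrim L (-1) g (-x) = -ε * quasiPrim L (-1) g x := by
  have hshift := hg.integral_add (x - L) x
  rw [sub_add_cancel] at hshift
  have hrefl : ∫ t in -x..-(x - L), g t = ε * ∫ t in (x - L)..x, g t := by
    rw [← intervalIntegral.integral_const_mul, ← intervalIntegral.integral_comp_neg]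
    exact intervalIntegral.integral_congr_ae (hε.mono fun t ht _ => ht)
  rw [quasiPrim, quasiPrim, hshift, show -x + L = -(x - L) by ring, hrefl]
  ring

lemma eq_quasiPrim (hG : IsQuasiPeriodic L z G) (hz : z ≠ 1) (h : IsPrimitive G g) :
    G = quasiPrim L z g := by
  funext x
  rw [quasiPrim, h.integral, hG, ← sub_one_mul, inv_mul_cancel_left₀ (sub_ne_zero.mpr hz)]

lemma integral_nat_mul_eq_zero (hg : IsQuasiPeriodic L z g) (hz : z ≠ 1) {q : ℕ} (hq : z ^ q = 1)
    (hint : ∀ x y, IntervalIntegrable g volume x y) (x : ℝ) : ∫ t in x..x + q * L, g t = 0 := by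
  rw [(hg.isPrimitive_quasiPrim hz hint).integral,
    hg.isQuasiPeriodic_quasiPrim.periodic_nat_mul hq, sub_self]

lemma norm_integral_le (hg : IsQuasiPeriodic L z g) (hL : 0 < L) (hz0 : z ≠ 0) (hz : z ≠ 1)
    (hB : ∀ c : ℤ, ‖1 - z ^ c‖ ≤ B) (hint : ∀ x y, IntervalIntegrable g volume x y)
    (hC : ∀ x, ‖g x‖ ≤ C) (x : ℝ) : ‖∫ t in (0 : ℝ)..x, g t‖ ≤ L / ‖1 - z‖ * (B * C) := by
  set c := ⌊x / L⌋
  set y := x - c * L with hy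
  have hy0 : 0 ≤ y := Int.sub_floor_div_mul_nonneg x hL
  have hyL : y ≤ L := (Int.sub_floor_div_mul_lt x hL).le
  -- Up to the factor `(z - 1)⁻¹`, shifting by `c L` multiplies the integral over `[y, L]` by
  -- `z ^ c - 1` and the one over `[0, y]`, which `quasiPrim` sees one period later, by
  -- `z ^ (c + 1) - 1`.
  have hsplit : ∫ t in (0 : ℝ)..x, g t = (z - 1)⁻¹ *
      ((z ^ c - 1) * (∫ t in y..L, g t) + (z ^ (c + 1) - 1) * ∫ t in (0 : ℝ)..y, g t) := by
    have hadd := hg.integral_add 0 y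
    have hx : x = y + c * L := by rw [hy, sub_add_cancel]
    rw [(hg.isPrimitive_quasiPrim hz hint).integral, hx, hg.isQuasiPeriodic_quasiPrim.int_mul hz0,
      quasiPrim, quasiPrim,
      ← intervalIntegral.integral_add_adjacent_intervals (hint y L) (hint L (y + L)),
      ← intervalIntegral.integral_add_adjacent_intervals (hint 0 y) (hint y (0 + L)),
      zpow_add_one₀ hz0]
    rw [zero_add] at hadd ⊢
    rw [hadd]
    ring
  have hB0 : 0 ≤ B := (norm_nonneg _).trans (hB 0)
  have hterm : ∀ (n : ℤ) {u v : ℝ}, u ≤ v → ‖(z ^ n - 1) * ∫ t in u..v, g t‖ ≤ B * (C * (v - u)) :=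
    fun n u v huv => by
      have h := intervalIntegral.norm_integral_le_of_norm_le_const (a := u) (b := v) fun t _ => hC t
      rw [abs_of_nonneg (sub_nonneg.mpr huv)] at h
      rw [norm_mul, norm_sub_rev]
      gcongr
      exact hB n
  calc ‖∫ t in (0 : ℝ)..x, g t‖ ≤ ‖1 - z‖⁻¹ * (B * (C * (L - y)) + B * (C * (y - 0))) := by
        rw [hsplit, norm_mul, norm_inv, norm_sub_rev]
        gcongr
        exact norm_add_le_of_le (hterm c hyL) (hterm (c + 1) hy0)
    _ = L / ‖1 - z‖ * (B * C) := by ring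

end IsQuasiPeriodic

end QuasiPeriodic

section Step

variable {X : Type*} {L : ℝ}

/-- `R` is a step function of width `L`: it is constant on every interval `[q L, (q + 1) L)`. -/
def IsStep (L : ℝ) (R : ℝ → X) : Prop := ∀ x y, ⌊x / L⌋ = ⌊y / L⌋ → R x = R y

lemma floor_div_eq_of_mem_Ico (hL : 0 < L) {q : ℤ} {x : ℝ}
    (hx : x ∈ Set.Ico (q * L) ((q + 1) * L)) : ⌊x / L⌋ = q :=
  Int.floor_eq_iff.mpr ⟨(le_div_iff₀ hL).mpr hx.1, (div_lt_iff₀ hL).mpr hx.2⟩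

namespace IsStep

variable {R : ℝ → X}

lemma of_nat_mul {n : ℕ} (hR : IsStep (n * L) R) : IsStep L R := fun x y h =>
  hR x y <| by
    simp only [mul_comm (n : ℝ), ← div_div, Int.floor_div_natCast, h]

lemma prod [CommMonoid X] {ι : Type*} {s : Finset ι} {R : ι → ℝ → X}
    (hR : ∀ i ∈ s, IsStep L (R i)) :
    IsStep L (fun x => ∏ i ∈ s, R i x) :=
  fun x y h => Finset.prod_congr rfl fun i hi => hR i hi x y h

lemma measurable [MeasurableSpace X] (hR : IsStep L R) : Measurable R := by
  have hfactor : R = (fun q : ℤ => R (Function.invFun (fun t : ℝ => ⌊t / L⌋) q)) ∘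
      fun x : ℝ => ⌊x / L⌋ := by
    funext x
    exact hR _ _ (Function.invFun_eq (f := fun t : ℝ => ⌊t / L⌋) ⟨x, rfl⟩).symm
  rw [hfactor]
  exact (measurable_of_countable _).comp (measurable_id.div_const L).floor

lemma eq_of_mem_Ico (hR : IsStep L R) (hL : 0 < L) {q : ℤ} {x : ℝ}
    (hx : x ∈ Set.Ico (q * L) ((q + 1) * L)) : R x = R (q * L) :=
  hR _ _ <| by rw [floor_div_eq_of_mem_Ico hL hx, mul_div_cancel_right₀ _ hL.ne', Int.floor_intCast]

end IsStep

variable {𝕜 : Type*} [RCLike 𝕜] {C : ℝ} {z : 𝕜} {G g R : ℝ → 𝕜}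

lemma IsStep.intervalIntegrable_mul (hR : IsStep L R) (hC : ∀ x, ‖R x‖ ≤ C) {x y : ℝ}
    (hg : IntervalIntegrable g volume x y) :
    IntervalIntegrable (fun t => g t * R t) volume x y := by
  rw [intervalIntegrable_iff] at hg ⊢
  exact hg.mul_bdd hR.measurable.aestronglyMeasurable (.of_forall hC)

namespace IsPrimitive

lemma integral_mul_isStep_of_mem_Icc (h : IsPrimitive G g) (hL : 0 < L) (hR : IsStep L R)
    (hG : ∀ q : ℤ, G (q * L) = 0) {q : ℤ} {y : ℝ} (hy : y ∈ Set.Icc (q * L) ((q + 1) * L)) :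
    ∫ t in (q * L)..y, g t * R t = G y * R y := by
  have hconst : ∫ t in (q * L)..y, g t * R t = ∫ t in (q * L)..y, g t * R (q * L) :=
    intervalIntegral.integral_congr_Ioo_of_le hy.1 fun t ht => by
      simp only [hR.eq_of_mem_Ico hL ⟨ht.1.le, ht.2.trans_le hy.2⟩]
  rw [hconst, intervalIntegral.integral_mul_const, h.integral, hG, sub_zero]
  rcases hy.2.lt_or_eq with hlt | rfl
  · rw [hR.eq_of_mem_Ico hL ⟨hy.1, hlt⟩]
  · have hGy : G ((q + 1) * L) = 0 := by exact_mod_cast hG (q + 1)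
    rw [hGy, zero_mul, zero_mul]

lemma mul_isStep (h : IsPrimitive G g) (hL : 0 < L) (hR : IsStep L R) (hC : ∀ x, ‖R x‖ ≤ C)
    (hG : ∀ q : ℤ, G (q * L) = 0) : IsPrimitive (fun x => G x * R x) (fun x => g x * R x) := by
  have hint : ∀ x y, IntervalIntegrable (fun t => g t * R t) volume x y :=
    fun x y => hR.intervalIntegrable_mul hC (h.integrable x y)
  have hzero : ∀ q : ℤ, ∫ t in (0 : ℝ)..q * L, g t * R t = 0 := fun q => by
    have hper : Function.Periodic (fun q : ℤ => ∫ t in (0 : ℝ)..q * L, g t * R t) 1 := fun q => by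
      have hy : ((q + 1 : ℤ) : ℝ) * L ∈ Set.Icc (q * L) ((q + 1) * L) :=
        ⟨by gcongr; simp, by simp⟩
      simp only
      rw [← intervalIntegral.integral_add_adjacent_intervals (hint 0 (q * L)) (hint _ _),
        h.integral_mul_isStep_of_mem_Icc hL hR hG hy, hG, zero_mul, add_zero]
    simpa using hper.int_mul_eq q
  have hfrom_zero : ∀ y, ∫ t in (0 : ℝ)..y, g t * R t = G y * R y := fun y => by
    rw [← intervalIntegral.integral_add_adjacent_intervals (hint _ (⌊y / L⌋ * L)) (hint _ _),
      hzero, zero_add]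
    exact h.integral_mul_isStep_of_mem_Icc hL hR hG
      ⟨(le_div_iff₀ hL).mp (Int.floor_le _), ((div_lt_iff₀ hL).mp (Int.lt_floor_add_one _)).le⟩
  refine ⟨hint, fun x y => ?_⟩
  rw [← intervalIntegral.integral_interval_sub_left (hint 0 y) (hint 0 x), hfrom_zero, hfrom_zero]

end IsPrimitive

/-- The step function with value `z ^ q` on `[q L, (q + 1) L)`. -/
noncomputable def stepChar (L : ℝ) (z : 𝕜) (x : ℝ) : 𝕜 := z ^ ⌊x / L⌋

lemma isStep_stepChar (L : ℝ) (z : 𝕜) : IsStep L (stepChar L z) := fun x y h => by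
  rw [stepChar, stepChar, h]

lemma norm_stepChar (hz : ‖z‖ = 1) (x : ℝ) : ‖stepChar L z x‖ = 1 := by
  rw [stepChar, norm_zpow, hz, one_zpow]

lemma stepChar_eq_one_of_mem_Ico (hL : 0 < L) {x : ℝ} (hx : x ∈ Set.Ico 0 L) :
    stepChar L z x = 1 := by
  rw [stepChar, floor_div_eq_of_mem_Ico (q := 0) hL (by simpa using hx), zpow_zero]

lemma isQuasiPeriodic_stepChar (hL : 0 < L) (hz : z ≠ 0) :
    IsQuasiPeriodic L z (stepChar L z) := fun x => by
  rw [stepChar, stepChar, add_div, div_self hL.ne', Int.floor_add_one, zpow_add_one₀ hz, mul_comm]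

lemma intervalIntegrable_stepChar (hz : ‖z‖ = 1) (x y : ℝ) :
    IntervalIntegrable (stepChar L z) volume x y := by
  simpa only [one_mul] using (isStep_stepChar L z).intervalIntegrable_mul
    (fun t => (norm_stepChar hz t).le) (intervalIntegrable_const (c := (1 : 𝕜)))

lemma stepChar_neg_one_neg_ae (hL : 0 < L) :
    ∀ᵐ x : ℝ, stepChar L (-1 : 𝕜) (-x) = -stepChar L (-1) x := by
  filter_upwards [(Set.countable_range fun q : ℤ => (q : ℝ) * L).ae_notMem volume] with x hx
  have hlt : (⌊x / L⌋ : ℝ) < x / L :=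
    (Int.floor_le _).lt_of_ne fun heq => hx ⟨⌊x / L⌋, by simp only [heq, div_mul_cancel₀ x hL.ne']⟩
  have hfloor : ⌊-x / L⌋ = -(⌊x / L⌋ + 1) := by
    rw [Int.floor_eq_iff, neg_div]
    push_cast
    constructor <;> linarith [Int.lt_floor_add_one (x / L)]
  have hne : (-1 : 𝕜) ≠ 0 := neg_ne_zero.mpr one_ne_zero
  rw [stepChar, stepChar, hfloor, zpow_neg, ← inv_zpow, inv_neg_one, zpow_add_one₀ hne, mul_neg_one]

end Step

section Tower

variable {𝕜 : Type*} [RCLike 𝕜]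

/-- Step characters of lengths `L 0, ..., L w` and factors `z 0, ..., z w`, each of them periodic
with respect to all later lengths and with respect to `1`. -/
structure StepTower (w : ℕ) (L : ℕ → ℝ) (z : ℕ → 𝕜) : Prop where
  pos : ∀ i ≤ w, 0 < L i
  norm_eq_one : ∀ i ≤ w, ‖z i‖ = 1
  ne_one : ∀ i ≤ w, z i ≠ 1
  period_lt : ∀ j ≤ w, ∀ i < j, ∃ q : ℕ, L j = q * L i ∧ z i ^ q = 1
  period_one : ∃ q : ℕ, 1 = q * L w ∧ z w ^ q = 1

/-- The mean value of the `n`-fold iterated integral of the first `n` step characters. -/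
noncomputable def towerMean (L : ℕ → ℝ) (z : ℕ → 𝕜) (n : ℕ) : 𝕜 :=
  ∏ i ∈ Finset.range n, (L i : 𝕜) / (1 - z i)

/-- The mean-zero part of the `n`-fold iterated integral of the first `n` step characters. -/
noncomputable def towerPrim (L : ℕ → ℝ) (z : ℕ → 𝕜) : ℕ → ℝ → 𝕜
  | 0 => 0
  | n + 1 => quasiPrim (L n) (z n)
      (fun x => (towerPrim L z n x + towerMean L z n) * stepChar (L n) (z n) x)

/-- The `n`-fold iterated integral, from `0`, of the first `n` step characters: at each stage the
previous integral is multiplied by the next character and integrated. -/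
noncomputable def towerIntegral (L : ℕ → ℝ) (z : ℕ → 𝕜) (n : ℕ) (x : ℝ) : 𝕜 :=
  towerPrim L z n x + towerMean L z n

lemma towerPrim_succ (L : ℕ → ℝ) (z : ℕ → 𝕜) (n : ℕ) : towerPrim L z (n + 1) =
    quasiPrim (L n) (z n) (fun x => towerIntegral L z n x * stepChar (L n) (z n) x) := rfl

namespace StepTower

variable {w n : ℕ} {L : ℕ → ℝ} {z : ℕ → 𝕜}

lemma ne_zero (h : StepTower w L z) (hn : n ≤ w) : z n ≠ 0 :=
  norm_ne_zero_iff.mp (by simp [h.norm_eq_one n hn])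

lemma isQuasiPeriodic_char (h : StepTower w L z) (hn : n ≤ w) :
    IsQuasiPeriodic (L n) (z n) (stepChar (L n) (z n)) :=
  isQuasiPeriodic_stepChar (h.pos n hn) (h.ne_zero hn)

lemma periodic_of_isQuasiPeriodic (h : StepTower w L z) {i j : ℕ} (hij : i < j) (hj : j ≤ w)
    {g : ℝ → 𝕜} (hg : IsQuasiPeriodic (L i) (z i) g) : Function.Periodic g (L j) := by
  obtain ⟨q, hq, hzq⟩ := h.period_lt j hj i hij
  rw [hq]
  exact hg.periodic_nat_mul hzq

lemma periodic_towerIntegral (h : StepTower w L z) (hn : n ≤ w) :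
    Function.Periodic (towerIntegral L z n) (L n) := by
  induction n with
  | zero => exact fun x => rfl
  | succ n ih =>
    have hn' : n ≤ w := n.le_succ.trans hn
    have hprim : IsQuasiPeriodic (L n) (z n) (towerPrim L z (n + 1)) :=
      ((h.isQuasiPeriodic_char hn').mul_periodic (ih hn')).isQuasiPeriodic_quasiPrim
    exact (h.periodic_of_isQuasiPeriodic n.lt_succ_self hn hprim).comp (· + towerMean L z (n + 1))

lemma isQuasiPeriodic_towerIntegral_mul (h : StepTower w L z) (hn : n ≤ w) :
    IsQuasiPeriodic (L n) (z n) (fun x => towerIntegral L z n x * stepChar (L n) (z n) x) :=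
  (h.isQuasiPeriodic_char hn).mul_periodic (h.periodic_towerIntegral hn)

lemma isQuasiPeriodic_towerPrim_succ (h : StepTower w L z) (hn : n ≤ w) :
    IsQuasiPeriodic (L n) (z n) (towerPrim L z (n + 1)) :=
  (h.isQuasiPeriodic_towerIntegral_mul hn).isQuasiPeriodic_quasiPrim

lemma intervalIntegrable_mul_stepChar (h : StepTower w L z) (hn : n ≤ w) {g : ℝ → 𝕜}
    (hg : Continuous g) (x y : ℝ) :
    IntervalIntegrable (fun t => g t * stepChar (L n) (z n) t) volume x y :=
  (isStep_stepChar _ _).intervalIntegrable_mul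
    (fun t => (norm_stepChar (h.norm_eq_one n hn) t).le) (hg.intervalIntegrable x y)

lemma continuous_towerPrim (h : StepTower w L z) (hn : n ≤ w + 1) :
    Continuous (towerPrim L z n) := by
  induction n with
  | zero => exact continuous_const
  | succ n ih =>
    have hn' : n ≤ w := Nat.succ_le_succ_iff.mp hn
    exact ((h.isQuasiPeriodic_towerIntegral_mul hn').isPrimitive_quasiPrim (h.ne_one n hn')
      (h.intervalIntegrable_mul_stepChar hn' ((ih (by omega)).add continuous_const))).continuous

lemma continuous_towerIntegral (h : StepTower w L z) (hn : n ≤ w + 1) :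
    Continuous (towerIntegral L z n) :=
  (h.continuous_towerPrim hn).add continuous_const

lemma isPrimitive_towerIntegral_succ (h : StepTower w L z) (hn : n ≤ w) :
    IsPrimitive (towerIntegral L z (n + 1))
      (fun x => towerIntegral L z n x * stepChar (L n) (z n) x) :=
  ((h.isQuasiPeriodic_towerIntegral_mul hn).isPrimitive_quasiPrim (h.ne_one n hn)
    (h.intervalIntegrable_mul_stepChar hn
      (h.continuous_towerIntegral (hn.trans w.le_succ)))).add_const _

lemma integral_towerPrim_period (h : StepTower w L z) (hn : n ≤ w) (x : ℝ) :
    ∫ t in x..x + L n, towerPrim L z n t = 0 := by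
  cases n with
  | zero => simp [towerPrim]
  | succ n =>
    have hn' : n ≤ w := n.le_succ.trans hn
    obtain ⟨q, hq, hzq⟩ := h.period_lt (n + 1) hn n n.lt_succ_self
    rw [hq]
    exact (h.isQuasiPeriodic_towerPrim_succ hn').integral_nat_mul_eq_zero (h.ne_one n hn') hzq
      (h.continuous_towerPrim (hn.trans w.le_succ)).intervalIntegrable x

lemma integral_towerIntegral_period (h : StepTower w L z) (hn : n ≤ w) (x : ℝ) :
    ∫ t in x..x + L n, towerIntegral L z n t = L n * towerMean L z n := by
  have hc := h.continuous_towerPrim (hn.trans w.le_succ)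
  simp only [towerIntegral]
  rw [intervalIntegral.integral_add (hc.intervalIntegrable _ _) intervalIntegrable_const,
    h.integral_towerPrim_period hn, intervalIntegral.integral_const, add_sub_cancel_left, zero_add,
    RCLike.real_smul_eq_coe_mul]

lemma towerIntegral_succ_zero (h : StepTower w L z) (hn : n ≤ w) :
    towerIntegral L z (n + 1) 0 = 0 := by
  have hfirst : ∫ t in (0 : ℝ)..0 + L n, towerIntegral L z n t * stepChar (L n) (z n) t
      = L n * towerMean L z n := by
    rw [← h.integral_towerIntegral_period hn 0]
    refine intervalIntegral.integral_congr_Ioo_of_le (by simpa using (h.pos n hn).le) fun t ht => ?_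
    rw [zero_add] at ht
    simp only [stepChar_eq_one_of_mem_Ico (h.pos n hn) ⟨ht.1.le, ht.2⟩, mul_one]
  have hz : 1 - z n ≠ 0 := sub_ne_zero.mpr (h.ne_one n hn).symm
  calc towerIntegral L z (n + 1) 0
      = (z n - 1)⁻¹ * (L n * towerMean L z n) + towerMean L z (n + 1) := by
        rw [towerIntegral, towerPrim_succ, quasiPrim, hfirst]
    _ = 0 := by
        rw [towerMean, towerMean, Finset.prod_range_succ, ← neg_sub 1 (z n), inv_neg]
        field_simp
        ring

lemma towerIntegral_succ_int_mul (h : StepTower w L z) (hn : n + 1 ≤ w) (q : ℤ) :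
    towerIntegral L z (n + 1) (q * L (n + 1)) = 0 := by
  rw [(h.periodic_towerIntegral hn).int_mul_eq, h.towerIntegral_succ_zero (n.le_succ.trans hn)]

lemma towerIntegral_succ_eq_integral (h : StepTower w L z) (hn : n ≤ w) (x : ℝ) :
    towerIntegral L z (n + 1) x
      = ∫ t in (0 : ℝ)..x, towerIntegral L z n t * stepChar (L n) (z n) t := by
  rw [(h.isPrimitive_towerIntegral_succ hn).integral, h.towerIntegral_succ_zero hn, sub_zero]

lemma isPrimitive_integral_towerPrim (h : StepTower w L z) (hn : n ≤ w) :
    IsPrimitive (fun x => ∫ t in (0 : ℝ)..x, towerPrim L z n t) (towerPrim L z n) :=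
  isPrimitive_integral (h.continuous_towerPrim (hn.trans w.le_succ)).intervalIntegrable

lemma periodic_integral_towerPrim (h : StepTower w L z) (hn : n ≤ w) :
    Function.Periodic (fun x => ∫ t in (0 : ℝ)..x, towerPrim L z n t) (L n) := fun x => by
  have hint := (h.isPrimitive_integral_towerPrim hn).integrable
  simp only
  rw [← intervalIntegral.integral_add_adjacent_intervals (hint 0 x) (hint x _),
    h.integral_towerPrim_period hn, add_zero]

lemma isPrimitive_integral_towerPrim_mul (h : StepTower w L z) (hn : n ≤ w) :
    IsPrimitive (fun x => (∫ t in (0 : ℝ)..x, towerPrim L z n t) * stepChar (L n) (z n) x)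
      (fun x => towerPrim L z n x * stepChar (L n) (z n) x) :=
  (h.isPrimitive_integral_towerPrim hn).mul_isStep (h.pos n hn) (isStep_stepChar _ _)
    (fun x => (norm_stepChar (h.norm_eq_one n hn) x).le) fun q => by
      rw [(h.periodic_integral_towerPrim hn).int_mul_eq, intervalIntegral.integral_same]

lemma intervalIntegrable_char (h : StepTower w L z) (hn : n ≤ w) (x y : ℝ) :
    IntervalIntegrable (stepChar (L n) (z n)) volume x y :=
  intervalIntegrable_stepChar (h.norm_eq_one n hn) x y

lemma integral_towerIntegral_mul (h : StepTower w L z) (hn : n ≤ w) (x y : ℝ) :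
    ∫ t in x..y, towerIntegral L z n t * stepChar (L n) (z n) t
      = (∫ t in x..y, towerPrim L z n t * stepChar (L n) (z n) t)
        + towerMean L z n * ∫ t in x..y, stepChar (L n) (z n) t := by
  simp only [towerIntegral, add_mul]
  rw [intervalIntegral.integral_add ((h.isPrimitive_integral_towerPrim_mul hn).integrable x y)
    ((h.intervalIntegrable_char hn x y).const_mul _), intervalIntegral.integral_const_mul]

lemma towerPrim_succ_eq (h : StepTower w L z) (hn : n ≤ w) (x : ℝ) :
    towerPrim L z (n + 1) x
      = (∫ t in (0 : ℝ)..x, towerPrim L z n t) * stepChar (L n) (z n) x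
        + towerMean L z n * quasiPrim (L n) (z n) (stepChar (L n) (z n)) x := by
  have hV := congrFun (((h.isQuasiPeriodic_char hn).mul_periodic
    (h.periodic_integral_towerPrim hn)).eq_quasiPrim (h.ne_one n hn)
    (h.isPrimitive_integral_towerPrim_mul hn)) x
  calc towerPrim L z (n + 1) x
      = (z n - 1)⁻¹ * ∫ t in x..x + L n, towerIntegral L z n t * stepChar (L n) (z n) t := by
        rw [towerPrim_succ, quasiPrim]
    _ = quasiPrim (L n) (z n) (fun t => towerPrim L z n t * stepChar (L n) (z n) t) x
        + towerMean L z n * quasiPrim (L n) (z n) (stepChar (L n) (z n)) x := by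
        rw [h.integral_towerIntegral_mul hn, quasiPrim, quasiPrim]
        ring
    _ = _ := by rw [← hV]

lemma towerIntegral_succ_eq (h : StepTower w L z) (hn : n ≤ w) (x : ℝ) :
    towerIntegral L z (n + 1) x
      = (∫ t in (0 : ℝ)..x, towerPrim L z n t) * stepChar (L n) (z n) x
        + towerMean L z n * ∫ t in (0 : ℝ)..x, stepChar (L n) (z n) t := by
  rw [h.towerIntegral_succ_eq_integral hn, h.integral_towerIntegral_mul hn,
    (h.isPrimitive_integral_towerPrim_mul hn).integral, intervalIntegral.integral_same, zero_mul,
    sub_zero]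

end StepTower

/-- Constants controlling the factors of a step tower: `m` and `M` bound the distances from `1` to
`z i` and to its powers, and `q` compares consecutive lengths. -/
structure TowerBounds (w : ℕ) (L : ℕ → ℝ) (z : ℕ → 𝕜) (m M q : ℝ) : Prop where
  pos : 0 < m
  nonneg : 0 ≤ q
  le_norm : ∀ i ≤ w, m ≤ ‖1 - z i‖
  norm_zpow_le : ∀ i ≤ w, ∀ c : ℤ, ‖1 - z i ^ c‖ ≤ M
  mul_le : ∀ i < w, M * L i ≤ q * L (i + 1)

namespace StepTower

variable {w n : ℕ} {L : ℕ → ℝ} {z : ℕ → 𝕜} {m M q : ℝ}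

lemma div_norm_one_sub_le (h : StepTower w L z) (hB : TowerBounds w L z m M q) (hn : n ≤ w) :
    L n / ‖1 - z n‖ ≤ L n / m :=
  div_le_div_of_nonneg_left (h.pos n hn).le hB.pos (hB.le_norm n hn)

lemma prod_div_nonneg (h : StepTower w L z) (hm : 0 < m) (hn : n ≤ w + 1) :
    0 ≤ ∏ i ∈ Finset.range n, L i / m :=
  Finset.prod_nonneg fun i hi =>
    div_nonneg (h.pos i (by have := Finset.mem_range.mp hi; omega)).le hm.le

lemma norm_towerMean_le (h : StepTower w L z) (hB : TowerBounds w L z m M q) (hn : n ≤ w + 1) :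
    ‖towerMean L z n‖ ≤ ∏ i ∈ Finset.range n, L i / m := by
  rw [towerMean, norm_prod]
  refine Finset.prod_le_prod (fun _ _ => norm_nonneg _) fun i hi => ?_
  have hi' : i ≤ w := by have := Finset.mem_range.mp hi; omega
  rw [norm_div, RCLike.norm_ofReal, abs_of_pos (h.pos i hi')]
  exact h.div_norm_one_sub_le hB hi'

lemma norm_integral_towerPrim_le (h : StepTower w L z) (hB : TowerBounds w L z m M q) (hn : n ≤ w)
    {s : ℝ} (hs0 : 0 ≤ s) (hs : ∀ x, ‖towerPrim L z n x‖ ≤ s * ∏ i ∈ Finset.range n, L i / m)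
    (x : ℝ) : ‖∫ t in (0 : ℝ)..x, towerPrim L z n t‖
      ≤ q * s * ∏ i ∈ Finset.range (n + 1), L i / m := by
  have hprod0 := h.prod_div_nonneg hB.pos (Nat.succ_le_succ hn)
  have hprod0' := h.prod_div_nonneg hB.pos (hn.trans w.le_succ)
  have hq := hB.nonneg
  cases n with
  | zero => simpa [towerPrim] using mul_nonneg (mul_nonneg hq hs0) (by simpa using hprod0)
  | succ n =>
    have hn' : n ≤ w := n.le_succ.trans hn
    have hM : 0 ≤ M := (norm_nonneg _).trans (hB.norm_zpow_le n hn' 0)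
    have hm := hB.pos
    calc ‖∫ t in (0 : ℝ)..x, towerPrim L z (n + 1) t‖
        ≤ L n / ‖1 - z n‖ * (M * (s * ∏ i ∈ Finset.range (n + 1), L i / m)) :=
          (h.isQuasiPeriodic_towerPrim_succ hn').norm_integral_le (h.pos n hn') (h.ne_zero hn')
            (h.ne_one n hn') (hB.norm_zpow_le n hn')
            (h.continuous_towerPrim (hn.trans w.le_succ)).intervalIntegrable hs x
      _ ≤ L n / m * (M * (s * ∏ i ∈ Finset.range (n + 1), L i / m)) := by
          gcongr ?_ * _
          exact h.div_norm_one_sub_le hB hn'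
      _ = M * L n / m * (s * ∏ i ∈ Finset.range (n + 1), L i / m) := by ring
      _ ≤ q * L (n + 1) / m * (s * ∏ i ∈ Finset.range (n + 1), L i / m) := by
          gcongr ?_ / m * _
          exact hB.mul_le n hn
      _ = q * s * ∏ i ∈ Finset.range (n + 2), L i / m := by
          rw [Finset.prod_range_succ _ (n + 1)]
          ring

lemma norm_towerPrim_le (h : StepTower w L z) (hB : TowerBounds w L z m M q) (hn : n ≤ w + 1)
    (x : ℝ) :
    ‖towerPrim L z n x‖ ≤ (∑ j ∈ Finset.range n, q ^ j) * ∏ i ∈ Finset.range n, L i / m := by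
  induction n generalizing x with
  | zero => simp [towerPrim]
  | succ n ih =>
    have hn' : n ≤ w := Nat.succ_le_succ_iff.mp hn
    have hV := h.norm_integral_towerPrim_le hB hn'
      (Finset.sum_nonneg fun j _ => pow_nonneg hB.nonneg j) (ih (by omega)) x
    have hχ := norm_quasiPrim_le (z := z n) (h.pos n hn').le
      (fun t => (norm_stepChar (L := L n) (h.norm_eq_one n hn') t).le) x
    rw [mul_one] at hχ
    rw [h.towerPrim_succ_eq hn']
    calc _ ≤ q * (∑ j ∈ Finset.range n, q ^ j) * ∏ i ∈ Finset.range (n + 1), L i / m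
          + (∏ i ∈ Finset.range n, L i / m) * (L n / m) := by
          refine norm_add_le_of_le ?_ ?_
          · rwa [norm_mul, norm_stepChar (h.norm_eq_one n hn'), mul_one]
          · rw [norm_mul]
            gcongr
            · exact h.prod_div_nonneg hB.pos (by omega)
            · exact h.norm_towerMean_le hB (by omega)
            · exact hχ.trans (h.div_norm_one_sub_le hB hn')
      _ = _ := by
          rw [Finset.prod_range_succ, Finset.sum_range_succ', Finset.mul_sum]
          simp only [pow_succ', pow_zero]
          ring

lemma norm_towerIntegral_succ_le (h : StepTower w L z) (hB : TowerBounds w L z m M q) (hn : n ≤ w)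
    (x : ℝ) : ‖towerIntegral L z (n + 1) x‖
      ≤ (M + q * ∑ j ∈ Finset.range n, q ^ j) * ∏ i ∈ Finset.range (n + 1), L i / m := by
  have hV := h.norm_integral_towerPrim_le hB hn
    (Finset.sum_nonneg fun j _ => pow_nonneg hB.nonneg j)
    (h.norm_towerPrim_le hB (hn.trans w.le_succ)) x
  have hM : 0 ≤ M := (norm_nonneg _).trans (hB.norm_zpow_le n hn 0)
  have hχ : ‖∫ t in (0 : ℝ)..x, stepChar (L n) (z n) t‖ ≤ L n / m * M := by
    have hχ := (h.isQuasiPeriodic_char hn).norm_integral_le (h.pos n hn) (h.ne_zero hn)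
      (h.ne_one n hn) (hB.norm_zpow_le n hn) (h.intervalIntegrable_char hn)
      (fun t => (norm_stepChar (h.norm_eq_one n hn) t).le) x
    rw [mul_one] at hχ
    exact hχ.trans (mul_le_mul_of_nonneg_right (h.div_norm_one_sub_le hB hn) hM)
  rw [h.towerIntegral_succ_eq hn]
  calc _ ≤ q * (∑ j ∈ Finset.range n, q ^ j) * ∏ i ∈ Finset.range (n + 1), L i / m
        + (∏ i ∈ Finset.range n, L i / m) * (L n / m * M) := by
        refine norm_add_le_of_le ?_ ?_
        · rwa [norm_mul, norm_stepChar (h.norm_eq_one n hn), mul_one]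
        · rw [norm_mul]
          gcongr
          · exact h.prod_div_nonneg hB.pos (by omega)
          · exact h.norm_towerMean_le hB (by omega)
    _ = _ := by
        rw [Finset.prod_range_succ]
        ring

end StepTower

/-- The iterated quasi-periodic primitives of the product of all step characters of the tower. -/
noncomputable def iterPrim (w : ℕ) (L : ℕ → ℝ) (z : ℕ → 𝕜) (n : ℕ) : ℝ → 𝕜 :=
  (quasiPrim (L w) (z w))^[n] fun x => ∏ i ∈ Finset.range (w + 1), stepChar (L i) (z i) x

lemma iterPrim_succ (w : ℕ) (L : ℕ → ℝ) (z : ℕ → 𝕜) (n : ℕ) :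
    iterPrim w L z (n + 1) = quasiPrim (L w) (z w) (iterPrim w L z n) :=
  Function.iterate_succ_apply' _ _ _

namespace StepTower

variable {w n : ℕ} {L : ℕ → ℝ} {z : ℕ → 𝕜}

lemma norm_prod_stepChar (h : StepTower w L z) {s : Finset ℕ} (hs : ∀ i ∈ s, i ≤ w) (x : ℝ) :
    ‖∏ i ∈ s, stepChar (L i) (z i) x‖ = 1 := by
  rw [norm_prod]
  exact Finset.prod_eq_one fun i hi => norm_stepChar (h.norm_eq_one i (hs i hi)) x

lemma isStep_prod_stepChar (h : StepTower w L z) {s : Finset ℕ} (hs : ∀ i ∈ s, n ≤ i ∧ i ≤ w) :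
    IsStep (L n) (fun x => ∏ i ∈ s, stepChar (L i) (z i) x) := by
  refine IsStep.prod fun i hi => ?_
  rcases (hs i hi).1.eq_or_lt with rfl | hlt
  · exact isStep_stepChar _ _
  · obtain ⟨q, hq, -⟩ := h.period_lt i (hs i hi).2 n hlt
    exact IsStep.of_nat_mul (n := q) (hq ▸ isStep_stepChar _ _)

lemma isQuasiPeriodic_prod_stepChar (h : StepTower w L z) (hn : n ≤ w) :
    IsQuasiPeriodic (L w) (z w) (fun x => ∏ i ∈ Finset.Ico n (w + 1), stepChar (L i) (z i) x) := by
  simp only [Finset.prod_Ico_succ_top hn]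
  refine (h.isQuasiPeriodic_char le_rfl).mul_periodic fun x => Finset.prod_congr rfl fun i hi => ?_
  have hi : i < w := (Finset.mem_Ico.mp hi).2
  exact h.periodic_of_isQuasiPeriodic hi le_rfl (h.isQuasiPeriodic_char hi.le) x

lemma isQuasiPeriodic_iterPrim (h : StepTower w L z) (n : ℕ) :
    IsQuasiPeriodic (L w) (z w) (iterPrim w L z n) := by
  induction n with
  | zero => simpa [iterPrim] using h.isQuasiPeriodic_prod_stepChar w.zero_le
  | succ n ih =>
    rw [iterPrim_succ]
    exact ih.isQuasiPeriodic_quasiPrim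

lemma isPrimitive_iterPrim_succ (h : StepTower w L z) (n : ℕ) :
    IsPrimitive (iterPrim w L z (n + 1)) (iterPrim w L z n) := by
  rw [iterPrim_succ]
  refine (h.isQuasiPeriodic_iterPrim n).isPrimitive_quasiPrim (h.ne_one w le_rfl) ?_
  induction n with
  | zero =>
    have hs : ∀ i ∈ Finset.range (w + 1), 0 ≤ i ∧ i ≤ w := fun i hi => by
      have := Finset.mem_range.mp hi
      omega
    simpa [iterPrim] using fun x y => (h.isStep_prod_stepChar hs).intervalIntegrable_mul
      (fun t => (h.norm_prod_stepChar (fun i hi => (hs i hi).2) t).le)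
      (intervalIntegrable_const (c := (1 : 𝕜)) (a := x) (b := y))
  | succ n ih =>
    rw [iterPrim_succ]
    exact ((h.isQuasiPeriodic_iterPrim n).isPrimitive_quasiPrim (h.ne_one w le_rfl)
      ih).continuous.intervalIntegrable

lemma iterPrim_apply_one (h : StepTower w L z) (n : ℕ) :
    iterPrim w L z n 1 = iterPrim w L z n 0 := by
  obtain ⟨q, hq, hzq⟩ := h.period_one
  rw [← zero_add 1, hq]
  exact (h.isQuasiPeriodic_iterPrim n).periodic_nat_mul hzq 0

lemma iterPrim_eq_towerIntegral_mul (h : StepTower w L z) (hn : n ≤ w) :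
    iterPrim w L z n =
      fun x => towerIntegral L z n x * ∏ i ∈ Finset.Ico n (w + 1), stepChar (L i) (z i) x := by
  induction n with
  | zero => simp [iterPrim, towerIntegral, towerPrim, towerMean]
  | succ n ih =>
    have hn' : n ≤ w := n.le_succ.trans hn
    have hs : ∀ i ∈ Finset.Ico (n + 1) (w + 1), n + 1 ≤ i ∧ i ≤ w := fun i hi => by
      have := Finset.mem_Ico.mp hi
      omega
    have hper : Function.Periodic (towerIntegral L z (n + 1)) (L w) :=
      (h.periodic_of_isQuasiPeriodic hn le_rfl (h.isQuasiPeriodic_towerPrim_succ hn')).comp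
        (· + towerMean L z (n + 1))
    have hprim := (h.isPrimitive_towerIntegral_succ hn').mul_isStep (h.pos (n + 1) hn)
      (h.isStep_prod_stepChar hs) (fun x => (h.norm_prod_stepChar (fun i hi => (hs i hi).2) x).le)
      (h.towerIntegral_succ_int_mul hn)
    rw [iterPrim_succ, ih hn', ((h.isQuasiPeriodic_prod_stepChar hn).mul_periodic hper).eq_quasiPrim
      (h.ne_one w le_rfl) hprim]
    simp only [Finset.prod_eq_prod_Ico_succ_bot (Nat.lt_succ_of_le hn'), mul_assoc]

lemma iterPrim_apply_zero (h : StepTower w L z) (hn0 : n ≠ 0) (hn : n ≤ w) :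
    iterPrim w L z n 0 = 0 := by
  obtain ⟨n, rfl⟩ := Nat.exists_eq_succ_of_ne_zero hn0
  simp only [h.iterPrim_eq_towerIntegral_mul hn, h.towerIntegral_succ_zero (n.le_succ.trans hn),
    zero_mul]

lemma norm_iterPrim_of_le (h : StepTower w L z) (hn : n ≤ w) (x : ℝ) :
    ‖iterPrim w L z n x‖ = ‖towerIntegral L z n x‖ := by
  have hs : ∀ i ∈ Finset.Ico n (w + 1), i ≤ w := fun i hi =>
    Nat.lt_succ_iff.mp (Finset.mem_Ico.mp hi).2
  rw [h.iterPrim_eq_towerIntegral_mul hn, norm_mul, h.norm_prod_stepChar hs, mul_one]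

lemma iterPrim_eq_towerPrim (h : StepTower w L z) :
    iterPrim w L z (w + 1) = towerPrim L z (w + 1) := by
  rw [iterPrim_succ, h.iterPrim_eq_towerIntegral_mul le_rfl, Nat.Ico_succ_singleton]
  simp only [Finset.prod_singleton]
  rfl

lemma norm_iterPrim_add_le (h : StepTower w L z) {m C : ℝ} (hm0 : 0 < m) (hm : m ≤ ‖1 - z w‖)
    (hC : ∀ x, ‖towerPrim L z (w + 1) x‖ ≤ C) (j : ℕ) (x : ℝ) :
    ‖iterPrim w L z (w + 1 + j) x‖ ≤ C * (L w / m) ^ j := by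
  have hL := (h.pos w le_rfl).le
  induction j generalizing x with
  | zero => simpa [h.iterPrim_eq_towerPrim] using hC x
  | succ j ih =>
    have hC0 : 0 ≤ C := (norm_nonneg _).trans (hC 0)
    rw [← add_assoc, iterPrim_succ]
    calc _ ≤ L w / ‖1 - z w‖ * (C * (L w / m) ^ j) := norm_quasiPrim_le hL ih x
      _ ≤ L w / m * (C * (L w / m) ^ j) := by gcongr
      _ = C * (L w / m) ^ (j + 1) := by ring

end StepTower

end Tower

section RealTower

variable {w n : ℕ} {L : ℕ → ℝ}

lemma towerMean_neg_one (L : ℕ → ℝ) (n : ℕ) :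
    towerMean L (fun _ => (-1 : ℝ)) n = ∏ i ∈ Finset.range n, L i / 2 :=
  Finset.prod_congr rfl fun i _ => by norm_num

namespace StepTower

-- The integrand `towerIntegral * stepChar` has absolute value `towerIntegral`, whose integral
-- over a period is known exactly.
lemma abs_towerPrim_neg_one_le (h : StepTower w L fun _ => (-1 : ℝ)) (hn : n ≤ w + 1) (x : ℝ) :
    |towerPrim L (fun _ => -1) n x| ≤ ∏ i ∈ Finset.range n, L i / 2 := by
  induction n generalizing x with
  | zero => simp [towerPrim]
  | succ n ih =>
    have hn' : n ≤ w := Nat.succ_le_succ_iff.mp hn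
    have habs : ∀ t, ‖towerIntegral L (fun _ => (-1 : ℝ)) n t * stepChar (L n) (-1) t‖
        = towerIntegral L (fun _ => -1) n t := fun t => by
      have hle := neg_le_of_abs_le (ih (hn'.trans w.le_succ) t)
      rw [← towerMean_neg_one, neg_le_iff_add_nonneg, ← towerIntegral] at hle
      rw [norm_mul, norm_stepChar (h.norm_eq_one n hn'), mul_one, Real.norm_of_nonneg hle]
    have hint := intervalIntegral.norm_integral_le_integral_norm (μ := volume)
      (f := fun t => towerIntegral L (fun _ => (-1 : ℝ)) n t * stepChar (L n) (-1) t)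
      (le_add_of_nonneg_right (h.pos n hn').le : x ≤ x + L n)
    simp only [habs] at hint
    rw [h.integral_towerIntegral_period hn', towerMean_neg_one] at hint
    calc |towerPrim L (fun _ => -1) (n + 1) x|
        = 2⁻¹ * ‖∫ t in x..x + L n,
            towerIntegral L (fun _ => (-1 : ℝ)) n t * stepChar (L n) (-1) t‖ := by
          rw [towerPrim_succ, quasiPrim, abs_mul]
          norm_num
      _ ≤ 2⁻¹ * (L n * ∏ i ∈ Finset.range n, L i / 2) := by
          gcongr
          exact hint
      _ = ∏ i ∈ Finset.range (n + 1), L i / 2 := by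
          rw [Finset.prod_range_succ]
          ring

lemma abs_towerIntegral_neg_one_le (h : StepTower w L fun _ => (-1 : ℝ)) (hn : n ≤ w + 1) (x : ℝ) :
    |towerIntegral L (fun _ => -1) n x| ≤ 2 * ∏ i ∈ Finset.range n, L i / 2 := by
  have hT := h.abs_towerPrim_neg_one_le hn x
  rw [towerIntegral, towerMean_neg_one]
  refine (abs_add_le _ _).trans ?_
  rw [abs_of_nonneg (h.prod_div_nonneg two_pos hn)]
  linarith

lemma towerPrim_neg_one_neg (h : StepTower w L fun _ => (-1 : ℝ)) (hn : n ≤ w + 1) (x : ℝ) :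
    towerPrim L (fun _ => (-1 : ℝ)) n (-x) = towerPrim L (fun _ => -1) n x := by
  induction n generalizing x with
  | zero => rfl
  | succ n ih =>
    have hn' : n ≤ w := Nat.succ_le_succ_iff.mp hn
    rw [towerPrim_succ, (h.isQuasiPeriodic_towerIntegral_mul hn').quasiPrim_neg (ε := -1) ?_,
      neg_neg, one_mul]
    · filter_upwards [stepChar_neg_one_neg_ae (𝕜 := ℝ) (h.pos n hn')] with t ht
      rw [ht, towerIntegral, towerIntegral, ih (hn'.trans w.le_succ)]
      ring

lemma iterPrim_neg_one_neg (h : StepTower w L fun _ => (-1 : ℝ)) (j : ℕ) (x : ℝ) :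
    iterPrim w L (fun _ => (-1 : ℝ)) (w + 1 + j) (-x)
      = (-1) ^ j * iterPrim w L (fun _ => -1) (w + 1 + j) x := by
  induction j generalizing x with
  | zero => simp [h.iterPrim_eq_towerPrim, h.towerPrim_neg_one_neg le_rfl]
  | succ j ih =>
    rw [← add_assoc, iterPrim_succ,
      (h.isQuasiPeriodic_iterPrim _).quasiPrim_neg (.of_forall ih), pow_succ', neg_one_mul]

lemma iterPrim_neg_one_apply_zero_of_odd (h : StepTower w L fun _ => (-1 : ℝ)) {j : ℕ}
    (hj : Odd j) : iterPrim w L (fun _ => (-1 : ℝ)) (w + 1 + j) 0 = 0 := by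
  have hneg := h.iterPrim_neg_one_neg j 0
  rw [neg_zero, hj.neg_one_pow] at hneg
  linarith

end StepTower

end RealTower

section IntegrationByParts

variable {E : Type*} [NormedAddCommGroup E] [NormedSpace ℝ E] [CompleteSpace E]
  {F : ℝ → ℝ} {a b : ℝ}

lemma integral_mul_of_isPrimitive {G g : ℝ → ℝ} (hF : AbsolutelyContinuousOnInterval F a b)
    (h : IsPrimitive G g) :
    ∫ x in a..b, F x * g x = F b * G b - F a * G a - ∫ x in a..b, deriv F x * G x := by
  set H := fun x => ∫ t in a..x, g t with hH
  have hint : IntervalIntegrable g volume a b := h.integrable a b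
  have hHac : AbsolutelyContinuousOnInterval H a b :=
    hint.absolutelyContinuousOnInterval_intervalIntegral Set.left_mem_uIcc
  have hderiv : ∫ x in a..b, F x * deriv H x = ∫ x in a..b, F x * g x := by
    refine intervalIntegral.integral_congr_ae ?_
    filter_upwards [hint.ae_hasDerivAt_integral] with x hx hxab
    rw [(hx (Set.uIoc_subset_uIcc hxab) a Set.left_mem_uIcc).deriv]
  have hG : ∀ x, G x = H x + G a := fun x => by
    simp only [hH, h.integral, sub_add_cancel]
  have hshift : ∫ x in a..b, deriv F x * G x
      = (∫ x in a..b, deriv F x * H x) + (F b - F a) * G a := by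
    have hsplit : ∀ x, deriv F x * G x = deriv F x * H x + deriv F x * G a := fun x => by
      rw [hG x, mul_add]
    rw [intervalIntegral.integral_congr fun x _ => hsplit x, intervalIntegral.integral_add
        (hF.intervalIntegrable_deriv.mul_continuousOn hHac.continuousOn)
        (hF.intervalIntegrable_deriv.mul_const _),
      intervalIntegral.integral_mul_const, hF.integral_deriv_eq_sub]
  rw [← hderiv, hF.integral_mul_deriv_eq_deriv_mul hHac, hshift, hG b,
    show H a = 0 from intervalIntegral.integral_same]
  ring

lemma integral_smul_of_isPrimitive {G g : ℝ → E} (hF : AbsolutelyContinuousOnInterval F a b)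
    (h : IsPrimitive G g) :
    ∫ x in a..b, F x • g x = F b • G b - F a • G a - ∫ x in a..b, deriv F x • G x := by
  rw [SeparatingDual.eq_iff_forall_dual_eq (R := ℝ)]
  intro φ
  have hint : IntervalIntegrable (fun x => F x • g x) volume a b :=
    (h.integrable a b).continuousOn_smul hF.continuousOn
  have hint' : IntervalIntegrable (fun x => deriv F x • G x) volume a b :=
    hF.intervalIntegrable_deriv.smul_continuousOn h.continuous.continuousOn
  rw [map_sub, map_sub, ← φ.intervalIntegral_comp_comm hint, ← φ.intervalIntegral_comp_comm hint']
  simpa only [map_smul, smul_eq_mul] using integral_mul_of_isPrimitive hF (h.clm_comp φ)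

end IntegrationByParts

section Derivatives

variable {E : Type*} [NormedAddCommGroup E] [NormedSpace ℝ E] [CompleteSpace E]
  {f : ℝ → ℝ} {α i : ℕ} {ψ : ℕ → ℝ → E}

lemma derivUnit_succ_eq_deriv (f : ℝ → ℝ) (i : ℕ) {x : ℝ} (hx : x ∈ Set.Ioo (0 : ℝ) 1) :
    derivUnit (i + 1) f x = deriv (derivUnit i f) x := by
  rw [derivUnit, iteratedDerivWithin_succ, derivWithin_of_mem_nhds (Icc_mem_nhds hx.1 hx.2)]
  rfl

lemma intervalIntegrable_derivUnit_succ (hf : AbsolutelyContinuousOnInterval (derivUnit i f) 0 1) :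
    IntervalIntegrable (derivUnit (i + 1) f) volume 0 1 := by
  refine hf.intervalIntegrable_deriv.congr_uIoo fun x hx => ?_
  rw [Set.uIoo_of_le zero_le_one] at hx
  exact (derivUnit_succ_eq_deriv f i hx).symm

lemma integral_derivUnit_succ (hf : AbsolutelyContinuousOnInterval (derivUnit i f) 0 1) :
    ∫ x in (0 : ℝ)..1, derivUnit (i + 1) f x = derivUnit i f 1 - derivUnit i f 0 := by
  rw [← hf.integral_deriv_eq_sub]
  exact intervalIntegral.integral_congr_Ioo_of_le zero_le_one fun x hx =>
    derivUnit_succ_eq_deriv f i hx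

lemma integral_derivUnit_smul_of_isPrimitive {G g : ℝ → E}
    (hf : AbsolutelyContinuousOnInterval (derivUnit i f) 0 1) (h : IsPrimitive G g)
    (hG : G 1 = G 0) :
    ∫ x in (0 : ℝ)..1, derivUnit i f x • g x
      = (∫ x in (0 : ℝ)..1, derivUnit (i + 1) f x) • G 0
        - ∫ x in (0 : ℝ)..1, derivUnit (i + 1) f x • G x := by
  have hcongr : ∫ x in (0 : ℝ)..1, derivUnit (i + 1) f x • G x
      = ∫ x in (0 : ℝ)..1, deriv (derivUnit i f) x • G x :=
    intervalIntegral.integral_congr_Ioo_of_le zero_le_one fun x hx => by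
      simp only [derivUnit_succ_eq_deriv f i hx]
  rw [integral_smul_of_isPrimitive hf h, hG, ← sub_smul, integral_derivUnit_succ hf, hcongr]

lemma integral_smul_eq_sum_of_isPrimitive
    (hf : ∀ i < α, AbsolutelyContinuousOnInterval (derivUnit i f) 0 1)
    (hψ : ∀ n, IsPrimitive (ψ (n + 1)) (ψ n)) (hψ1 : ∀ n, ψ (n + 1) 1 = ψ (n + 1) 0) :
    ∫ x in (0 : ℝ)..1, f x • ψ 0 x
      = (∑ i ∈ Finset.range α,
          (-1 : ℝ) ^ i • (∫ x in (0 : ℝ)..1, derivUnit (i + 1) f x) • ψ (i + 1) 0)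
        + (-1 : ℝ) ^ α • ∫ x in (0 : ℝ)..1, derivUnit α f x • ψ α x := by
  induction α with
  | zero => simp [derivUnit]
  | succ n ih =>
    rw [ih fun i hi => hf i (hi.trans n.lt_succ_self), Finset.sum_range_succ,
      integral_derivUnit_smul_of_isPrimitive (hf n n.lt_succ_self) (hψ n) (hψ1 n)]
    module

lemma norm_integral_smul_le_of_isPrimitive
    (hf : ∀ i < α, AbsolutelyContinuousOnInterval (derivUnit i f) 0 1)
    (hint : IntervalIntegrable (derivUnit α f) volume 0 1)
    (hψ : ∀ n, IsPrimitive (ψ (n + 1)) (ψ n)) (hψ1 : ∀ n, ψ (n + 1) 1 = ψ (n + 1) 0)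
    {K : ℝ} (hK : ∀ x, ‖ψ α x‖ ≤ K) :
    ‖∫ x in (0 : ℝ)..1, f x • ψ 0 x‖
      ≤ ∑ i ∈ Finset.Icc 1 α, |∫ x in (0 : ℝ)..1, derivUnit i f x| * ‖ψ i 0‖
        + (∫ x in (0 : ℝ)..1, |derivUnit α f x|) * K := by
  have hsum : ∑ i ∈ Finset.Icc 1 α, |∫ x in (0 : ℝ)..1, derivUnit i f x| * ‖ψ i 0‖
      = ∑ i ∈ Finset.range α,
          ‖(-1 : ℝ) ^ i • (∫ x in (0 : ℝ)..1, derivUnit (i + 1) f x) • ψ (i + 1) 0‖ := by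
    simp only [norm_smul, norm_pow, norm_neg, norm_one, one_pow, one_mul, Real.norm_eq_abs]
    rw [Finset.range_eq_Ico, Finset.sum_Ico_add'
      (fun i => |∫ x in (0 : ℝ)..1, derivUnit i f x| * ‖ψ i 0‖) 0 α 1]
    rfl
  rw [integral_smul_eq_sum_of_isPrimitive hf hψ hψ1, hsum]
  refine norm_add_le_of_le (norm_sum_le _ _) ?_
  rw [norm_smul, norm_pow, norm_neg, norm_one, one_pow, one_mul,
    ← intervalIntegral.integral_mul_const]
  refine intervalIntegral.norm_integral_le_of_norm_le zero_le_one (.of_forall fun x _ => ?_)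
    (hint.abs.mul_const K)
  rw [norm_smul, Real.norm_eq_abs]
  exact mul_le_mul_of_nonneg_left (hK x) (abs_nonneg _)

end Derivatives

section RootsOfUnity

variable {b : ℕ} {z : ℂ}

lemma norm_one_sub_pow_le (hz : ‖z‖ = 1) (n : ℕ) : ‖1 - z ^ n‖ ≤ n * ‖1 - z‖ := by
  rw [← geom_sum_mul_neg, norm_mul]
  gcongr
  refine (norm_sum_le _ _).trans_eq ?_
  simp [norm_pow, hz]

lemma sum_one_sub_pow_of_pow_eq_one (hz : z ^ b = 1) (hz1 : z ≠ 1) :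
    ∑ j ∈ Finset.range b, (1 - z ^ j) = b := by
  have hgeom : ∑ j ∈ Finset.range b, z ^ j = 0 := by rw [geom_sum_eq hz1, hz, sub_self, zero_div]
  simp [Finset.sum_sub_distrib, hgeom]

lemma two_le_mul_norm_one_sub (hb : b ≠ 0) (hz : z ^ b = 1) (hz1 : z ≠ 1) :
    2 ≤ b * ‖1 - z‖ := by
  have hb0 : (0 : ℝ) < b := by exact_mod_cast Nat.pos_of_ne_zero hb
  have hgauss : (∑ j ∈ Finset.range b, (j : ℝ)) * 2 = b * (b - 1) := by
    have hgauss := congrArg (Nat.cast : ℕ → ℝ) (Finset.sum_range_id_mul_two b)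
    rwa [Nat.cast_mul, Nat.cast_mul, Nat.cast_pred (Nat.pos_of_ne_zero hb), Nat.cast_sum,
      Nat.cast_ofNat] at hgauss
  have hsum : (b : ℝ) ≤ (∑ j ∈ Finset.range b, (j : ℝ)) * ‖1 - z‖ := by
    calc (b : ℝ) = ‖∑ j ∈ Finset.range b, (1 - z ^ j)‖ := by
          rw [sum_one_sub_pow_of_pow_eq_one hz hz1, Complex.norm_natCast]
      _ ≤ ∑ j ∈ Finset.range b, j * ‖1 - z‖ := norm_sum_le_of_le _ fun j _ =>
          norm_one_sub_pow_le (Complex.norm_eq_one_of_pow_eq_one hz hb) j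
      _ = _ := (Finset.sum_mul _ _ _).symm
  have hle : b * 2 ≤ b * ((b - 1) * ‖1 - z‖) := by
    linear_combination 2 * hsum + ‖1 - z‖ * hgauss
  linarith [le_of_mul_le_mul_left hle hb0, norm_nonneg (1 - z)]

lemma isPrimitiveRoot_conj_exp (hb : b ≠ 0) :
    IsPrimitiveRoot (starRingEnd ℂ (Complex.exp (2 * Real.pi * Complex.I / b))) b :=
  (Complex.isPrimitiveRoot_exp b hb).map_of_injective (starRingEnd ℂ).injective

lemma rootDistances_eq_image (hb : b ≠ 0) :
    rootDistances b = (fun z : ℂ => ‖1 - z‖) '' {z | z ^ b = 1 ∧ z ≠ 1} := by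
  have hω := isPrimitiveRoot_conj_exp hb
  refine (Set.image_image (fun z : ℂ => ‖1 - z‖) _ _).symm.trans (congrArg _ ?_)
  ext z
  constructor
  · rintro ⟨c, hc, rfl⟩
    have hcb : c < b := by have := hc.2; omega
    exact ⟨by simp only [pow_right_comm, hω.pow_eq_one, one_pow],
      hω.pow_ne_one_of_pos_of_lt (Nat.one_le_iff_ne_zero.mp hc.1) hcb⟩
  · rintro ⟨hz, hz1⟩
    have : NeZero b := ⟨hb⟩
    obtain ⟨c, hc, rfl⟩ := hω.eq_pow_of_pow_eq_one hz
    have hc0 : c ≠ 0 := fun h => hz1 (by rw [h, pow_zero])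
    exact ⟨c, ⟨by omega, by omega⟩, rfl⟩

lemma finite_rootDistances (b : ℕ) : (rootDistances b).Finite :=
  (Set.finite_Icc _ _).image _

lemma nonempty_rootDistances (hb : 2 ≤ b) : (rootDistances b).Nonempty :=
  (Set.nonempty_Icc.mpr (by omega)).image _

lemma mMin_le_norm_one_sub (hb : b ≠ 0) (hz : z ^ b = 1) (hz1 : z ≠ 1) : mMin b ≤ ‖1 - z‖ :=
  csInf_le (finite_rootDistances b).bddBelow (rootDistances_eq_image hb ▸ ⟨z, ⟨hz, hz1⟩, rfl⟩)

lemma norm_one_sub_le_mMax (hb : b ≠ 0) (hz : z ^ b = 1) : ‖1 - z‖ ≤ mMax b := by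
  by_cases hz1 : z = 1
  · rw [hz1, sub_self, norm_zero]
    exact Real.sSup_nonneg (by rintro _ ⟨c, -, rfl⟩; exact norm_nonneg _)
  · exact le_csSup (finite_rootDistances b).bddAbove
      (rootDistances_eq_image hb ▸ ⟨z, ⟨hz, hz1⟩, rfl⟩)

lemma two_le_mul_mMin (hb : 2 ≤ b) : 2 ≤ b * mMin b := by
  have hb0 : b ≠ 0 := by omega
  obtain ⟨z, ⟨hz, hz1⟩, hmin⟩ : mMin b ∈ (fun z : ℂ => ‖1 - z‖) '' {z | z ^ b = 1 ∧ z ≠ 1} :=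
    rootDistances_eq_image hb0 ▸ (nonempty_rootDistances hb).csInf_mem (finite_rootDistances b)
  exact hmin ▸ two_le_mul_norm_one_sub hb0 hz hz1

lemma mMin_pos (hb : 2 ≤ b) : 0 < mMin b :=
  pos_of_mul_pos_right (two_pos.trans_le (two_le_mul_mMin hb)) b.cast_nonneg

lemma mMax_le_two (hb : 2 ≤ b) : mMax b ≤ 2 := by
  have hb0 : b ≠ 0 := by omega
  refine csSup_le (nonempty_rootDistances hb) ?_
  rw [rootDistances_eq_image hb0]
  rintro _ ⟨z, ⟨hz, -⟩, rfl⟩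
  refine (norm_sub_le _ _).trans_eq ?_
  rw [norm_one, Complex.norm_eq_one_of_pow_eq_one hz hb0, one_add_one_eq_two]

lemma one_le_mMax (hb : 2 ≤ b) : 1 ≤ mMax b := by
  have hb0 : b ≠ 0 := by omega
  have hω := isPrimitiveRoot_conj_exp hb0
  set ω := starRingEnd ℂ (Complex.exp (2 * Real.pi * Complex.I / b))
  have hsum : (b : ℝ) ≤ b * mMax b := by
    calc (b : ℝ) = ‖∑ j ∈ Finset.range b, (1 - ω ^ j)‖ := by
          rw [sum_one_sub_pow_of_pow_eq_one hω.pow_eq_one (hω.ne_one hb), Complex.norm_natCast]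
      _ ≤ ∑ _j ∈ Finset.range b, mMax b := norm_sum_le_of_le _ fun j _ =>
          norm_one_sub_le_mMax hb0 (by rw [pow_right_comm, hω.pow_eq_one, one_pow])
      _ = b * mMax b := by rw [Finset.sum_const, Finset.card_range, nsmul_eq_mul]
  exact (le_mul_iff_one_le_right (by positivity)).mp hsum

lemma mMax_div_nonneg (hb : 2 ≤ b) : 0 ≤ mMax b / b :=
  div_nonneg (zero_le_one.trans (one_le_mMax hb)) b.cast_nonneg

lemma mMax_div_le_mMin (hb : 2 ≤ b) : mMax b / b ≤ mMin b :=
  div_le_of_le_mul₀ b.cast_nonneg (mMin_pos hb).le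
    (((mMax_le_two hb).trans (two_le_mul_mMin hb)).trans_eq (mul_comm _ _))

lemma walshConst_eq_mul_sum (hb : 2 < b) (v : ℕ) :
    walshConst b v = mMin b * ∑ j ∈ Finset.range v, (mMax b / b) ^ j := by
  have hb2 : (2 : ℝ) < b := by exact_mod_cast hb
  have hlt : mMax b < b := (mMax_le_two hb.le).trans_lt hb2
  have hne : (b : ℝ) ≠ 0 := by linarith
  have hne' : (b : ℝ) - mMax b ≠ 0 := by linarith
  rw [walshConst, ← geom_sum_mul_neg]
  field_simp

lemma mMax_div_mul_sum_le_walshConst (hb : 2 < b) {n v : ℕ} (hn : n ≤ v) :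
    mMax b / b * ∑ j ∈ Finset.range n, (mMax b / b) ^ j ≤ walshConst b v := by
  have hq := mMax_div_nonneg hb.le
  rw [walshConst_eq_mul_sum hb]
  refine mul_le_mul (mMax_div_le_mMin hb.le) (Finset.sum_le_sum_of_subset_of_nonneg
    (Finset.range_mono hn) fun j _ _ => pow_nonneg hq j)
    (Finset.sum_nonneg fun j _ => pow_nonneg hq j) (mMin_pos hb.le).le

lemma sum_mMax_div_pow_le (hb : 2 < b) (w : ℕ) :
    ∑ j ∈ Finset.range (w + 1), (mMax b / b) ^ j ≤ 1 + walshConst b (w + 1) := by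
  rw [geom_sum_succ, add_comm]
  exact add_le_add_right (mMax_div_mul_sum_le_walshConst hb w.le_succ) 1

end RootsOfUnity

section WalshTower

variable {b k i n : ℕ}

lemma walshDigit_ne_zero {a : ℕ} (ha : a ∈ walshPositions b k) : walshDigit b k a ≠ 0 :=
  (Finset.mem_filter.mp ha).2

lemma one_le_of_mem_walshPositions {a : ℕ} (ha : a ∈ walshPositions b k) : 1 ≤ a :=
  (Finset.mem_Icc.mp (Finset.mem_filter.mp ha).1).1

lemma walshDigit_lt (hb : 2 ≤ b) (k a : ℕ) : walshDigit b k a < b := by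
  rw [walshDigit]
  rcases lt_or_ge (a - 1) (Nat.digits b k).length with h | h
  · rw [List.getD_eq_getElem _ _ h]
    exact Nat.digits_lt_base hb (List.getElem_mem h)
  · rw [List.getD_eq_default _ _ h]
    omega

lemma walshWeight_pos (hk : k ≠ 0) : 0 < walshWeight b k := by
  have hne : Nat.digits b k ≠ [] := Nat.digits_ne_nil_iff_ne_zero.mpr hk
  have hlen := List.length_pos_iff.mpr hne
  refine Finset.card_pos.mpr ⟨(Nat.digits b k).length,
    Finset.mem_filter.mpr ⟨Finset.mem_Icc.mpr ⟨hlen, le_rfl⟩, ?_⟩⟩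
  rw [walshDigit, List.getD_eq_getElem _ _ (by omega), ← List.getLast_eq_getElem hne]
  exact Nat.getLast_digit_ne_zero b hk

lemma walshPos_succ_eq_getElem (hi : i < ((walshPositions b k).sort (· ≥ ·)).length) :
    walshPos b k (i + 1) = ((walshPositions b k).sort (· ≥ ·))[i] := by
  rw [walshPos, Nat.add_sub_cancel, List.getD_eq_getElem _ _ hi]

lemma length_sort_walshPositions (b k : ℕ) :
    ((walshPositions b k).sort (· ≥ ·)).length = walshWeight b k :=
  Finset.length_sort _

lemma walshPos_mem (hi : i < walshWeight b k) : walshPos b k (i + 1) ∈ walshPositions b k := by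
  rw [walshPos_succ_eq_getElem (by rwa [length_sort_walshPositions]), ← Finset.mem_sort (· ≥ ·)]
  exact List.getElem_mem _

lemma walshPos_lt {j : ℕ} (hij : i < j) (hj : j < walshWeight b k) :
    walshPos b k (j + 1) < walshPos b k (i + 1) := by
  have hj' : j < ((walshPositions b k).sort (· ≥ ·)).length := by
    rwa [length_sort_walshPositions]
  rw [walshPos_succ_eq_getElem hj', walshPos_succ_eq_getElem (hij.trans hj')]
  exact List.pairwise_iff_getElem.mp (Finset.sortedGT_sort _).pairwise i j _ hj' hij

lemma injOn_walshPos (b k : ℕ) :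
    Set.InjOn (fun i => walshPos b k (i + 1)) (Finset.range (walshWeight b k)) :=
  StrictAntiOn.injOn fun _ _ _ hj hij => walshPos_lt hij (Finset.mem_range.mp hj)

lemma image_walshPos (b k : ℕ) :
    (Finset.range (walshWeight b k)).image (fun i => walshPos b k (i + 1))
      = walshPositions b k := by
  refine Finset.eq_of_subset_of_card_le (fun a ha => ?_) ?_
  · obtain ⟨i, hi, rfl⟩ := Finset.mem_image.mp ha
    exact walshPos_mem (Finset.mem_range.mp hi)
  · rw [Finset.card_image_of_injOn (injOn_walshPos b k), Finset.card_range, walshWeight]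

lemma prod_walshPositions {M : Type*} [CommMonoid M] (F : ℕ → M) :
    ∏ a ∈ walshPositions b k, F a
      = ∏ i ∈ Finset.range (walshWeight b k), F (walshPos b k (i + 1)) := by
  rw [← image_walshPos, Finset.prod_image (injOn_walshPos b k)]

/-- The lengths `b ^ (-a_i)` attached to the nonzero digits of `k`, indexed from `0`. -/
noncomputable def walshLength (b k i : ℕ) : ℝ := ((b : ℝ) ^ walshPos b k (i + 1))⁻¹

/-- The roots of unity `ω ^ (-κ_i)` attached to the nonzero digits of `k`, indexed from `0`. -/
noncomputable def walshRoot (b k i : ℕ) : ℂ :=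
  starRingEnd ℂ (Complex.exp (2 * Real.pi * Complex.I / b)) ^ walshDigit b k (walshPos b k (i + 1))

lemma walshRoot_pow (hb : b ≠ 0) (k i : ℕ) : walshRoot b k i ^ b = 1 := by
  rw [walshRoot, pow_right_comm, (isPrimitiveRoot_conj_exp hb).pow_eq_one, one_pow]

lemma walshRoot_ne_one (hb : 2 ≤ b) (hi : i < walshWeight b k) : walshRoot b k i ≠ 1 :=
  (isPrimitiveRoot_conj_exp (by omega)).pow_ne_one_of_pos_of_lt
    (walshDigit_ne_zero (walshPos_mem hi)) (walshDigit_lt hb k _)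

lemma walshRoot_two (hi : i < walshWeight 2 k) : walshRoot 2 k i = -1 :=
  (sq_eq_one_iff.mp (walshRoot_pow two_ne_zero k i)).resolve_left (walshRoot_ne_one le_rfl hi)

lemma walshLength_pos (hb : 0 < b) (k i : ℕ) : 0 < walshLength b k i := by
  have : (0 : ℝ) < b := by exact_mod_cast hb
  exact inv_pos.mpr (pow_pos this _)

lemma walshLength_eq_pow_mul (hb : 0 < b) {j : ℕ} (hij : i < j) (hj : j < walshWeight b k) :
    ∃ d : ℕ, walshLength b k j = (b : ℝ) ^ (d + 1) * walshLength b k i := by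
  have hb0 : (b : ℝ) ≠ 0 := by exact_mod_cast hb.ne'
  obtain ⟨d, hd⟩ := Nat.exists_eq_add_of_lt (walshPos_lt hij hj)
  refine ⟨d, ?_⟩
  rw [walshLength, walshLength, hd, add_assoc, add_comm _ (d + 1), pow_add _ (d + 1), mul_inv,
    mul_inv_cancel_left₀ (pow_ne_zero _ hb0)]

lemma one_eq_pow_mul_walshLength (hb : 0 < b) (hi : i < walshWeight b k) :
    ∃ d : ℕ, 1 = (b : ℝ) ^ (d + 1) * walshLength b k i := by
  have hb0 : (b : ℝ) ≠ 0 := by exact_mod_cast hb.ne'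
  obtain ⟨d, hd⟩ := Nat.exists_eq_add_of_le' (one_le_of_mem_walshPositions (walshPos_mem hi))
  exact ⟨d, by rw [walshLength, hd, mul_inv_cancel₀ (pow_ne_zero _ hb0)]⟩

lemma mul_walshLength_le (hb : 0 < b) (hi : i + 1 < walshWeight b k) :
    b * walshLength b k i ≤ walshLength b k (i + 1) := by
  obtain ⟨d, hd⟩ := walshLength_eq_pow_mul hb i.lt_succ_self hi
  have hb1 : (1 : ℝ) ≤ b := by exact_mod_cast hb
  rw [hd, pow_succ']
  exact mul_le_mul_of_nonneg_right (le_mul_of_one_le_right (by linarith) (one_le_pow₀ hb1))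
    (walshLength_pos hb k i).le

lemma stepTower_walshLength {𝕜 : Type*} [RCLike 𝕜] {w : ℕ} {z : ℕ → 𝕜} (hb : 0 < b)
    (hw : walshWeight b k = w + 1) (hz : ∀ i ≤ w, z i ^ b = 1) (hz1 : ∀ i ≤ w, z i ≠ 1) :
    StepTower w (walshLength b k) z := by
  have hpow : ∀ i ≤ w, ∀ d, z i ^ b ^ (d + 1) = 1 := fun i hi d => by
    rw [pow_succ', pow_mul, hz i hi, one_pow]
  refine ⟨fun i _ => walshLength_pos hb k i, fun i hi => ?_, hz1, fun j hj i hij => ?_, ?_⟩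
  · exact (pow_eq_one_iff_of_nonneg (norm_nonneg _) hb.ne').mp
      (by rw [← norm_pow, hz i hi, norm_one])
  · obtain ⟨d, hd⟩ := walshLength_eq_pow_mul (k := k) hb hij (by omega)
    exact ⟨b ^ (d + 1), by rw [hd, Nat.cast_pow], hpow i (hij.le.trans hj) d⟩
  · obtain ⟨d, hd⟩ := one_eq_pow_mul_walshLength (k := k) (i := w) hb (by omega)
    exact ⟨b ^ (d + 1), by rw [Nat.cast_pow, ← hd], hpow w le_rfl d⟩

lemma stepTower_walshRoot {w : ℕ} (hb : 2 ≤ b) (hw : walshWeight b k = w + 1) :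
    StepTower w (walshLength b k) (walshRoot b k) :=
  stepTower_walshLength (by omega) hw (fun i _ => walshRoot_pow (by omega) k i)
    fun i hi => walshRoot_ne_one hb (by omega)

lemma stepTower_walshLength_two {w : ℕ} (hw : walshWeight 2 k = w + 1) :
    StepTower w (walshLength 2 k) fun _ => (-1 : ℝ) :=
  stepTower_walshLength two_pos hw (fun _ _ => by norm_num) fun _ _ => by norm_num

lemma towerBounds_walshRoot {w : ℕ} (hb : 2 ≤ b) (hw : walshWeight b k = w + 1) :
    TowerBounds w (walshLength b k) (walshRoot b k) (mMin b) (mMax b) (mMax b / b) where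
  pos := mMin_pos hb
  nonneg := mMax_div_nonneg hb
  le_norm i hi := mMin_le_norm_one_sub (by omega) (walshRoot_pow (by omega) k i)
    (walshRoot_ne_one hb (by omega))
  norm_zpow_le i _ c := norm_one_sub_le_mMax (b := b) (by omega) (by
    rw [← zpow_natCast, zpow_comm, zpow_natCast, walshRoot_pow (by omega), one_zpow])
  mul_le i hi := by
    have hb0 : (b : ℝ) ≠ 0 := by exact_mod_cast (by omega : b ≠ 0)
    calc mMax b * walshLength b k i = mMax b / b * (b * walshLength b k i) := by field_simp
      _ ≤ mMax b / b * walshLength b k (i + 1) := mul_le_mul_of_nonneg_left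
          (mul_walshLength_le (by omega) (by omega)) (mMax_div_nonneg hb)

lemma conj_walsh [NeZero b] {x : ℝ} (hx : 0 ≤ x) :
    starRingEnd ℂ (walsh b k x) = ∏ i ∈ Finset.range (walshWeight b k),
      stepChar (walshLength b k i) (walshRoot b k i) x := by
  rw [walsh, map_pow, ← Finset.prod_pow_eq_pow_sum, prod_walshPositions]
  refine Finset.prod_congr rfl fun i hi => ?_
  have ha := one_le_of_mem_walshPositions (walshPos_mem (Finset.mem_range.mp hi))
  rw [pow_mul, ← walshRoot, stepChar, walshLength, div_inv_eq_mul,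
    ← Int.natCast_floor_eq_floor (by positivity), zpow_natCast, Real.digits, Nat.sub_add_cancel ha,
    Fin.val_ofNat, ← pow_eq_pow_mod _ (walshRoot_pow (NeZero.ne b) k i)]

lemma walshCoeff_eq_integral [NeZero b] {w : ℕ} (hw : walshWeight b k = w + 1) (f : ℝ → ℝ) :
    walshCoeff b f k
      = ∫ x in (0 : ℝ)..1, f x • iterPrim w (walshLength b k) (walshRoot b k) 0 x := by
  rw [walshCoeff, intervalIntegral.integral_of_le zero_le_one, ← integral_Ico_eq_integral_Ioc]
  refine setIntegral_congr_fun measurableSet_Ico fun x hx => ?_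
  simp only [conj_walsh hx.1, hw, Complex.real_smul]
  rfl

lemma walshCoeff_two_eq_integral {w : ℕ} (hw : walshWeight 2 k = w + 1) (f : ℝ → ℝ) :
    walshCoeff 2 f k
      = (∫ x in (0 : ℝ)..1, f x • iterPrim w (walshLength 2 k) (fun _ => (-1 : ℝ)) 0 x : ℝ) := by
  rw [walshCoeff_eq_integral hw, ← intervalIntegral.integral_ofReal]
  refine intervalIntegral.integral_congr fun x _ => ?_
  have hprod : iterPrim w (walshLength 2 k) (walshRoot 2 k) 0 x
      = (iterPrim w (walshLength 2 k) (fun _ => (-1 : ℝ)) 0 x : ℝ) := by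
    simp only [iterPrim, Function.iterate_zero, id_eq, Complex.ofReal_prod]
    refine Finset.prod_congr rfl fun i hi => ?_
    rw [walshRoot_two (hw ▸ Finset.mem_range.mp hi)]
    simp [stepChar]
  simp only [hprod, Complex.real_smul, smul_eq_mul, Complex.ofReal_mul]

lemma sum_Icc_walshPos (b k n : ℕ) :
    ∑ i ∈ Finset.Icc 1 n, walshPos b k i = ∑ i ∈ Finset.range n, walshPos b k (i + 1) := by
  rw [Finset.range_eq_Ico, Finset.sum_Ico_add' (walshPos b k) 0 n 1]
  rfl

lemma prod_walshLength_div (b k n : ℕ) (m : ℝ) :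
    ∏ i ∈ Finset.range n, walshLength b k i / m
      = ((b : ℝ) ^ ∑ i ∈ Finset.Icc 1 n, walshPos b k i)⁻¹ / m ^ n := by
  rw [sum_Icc_walshPos, Finset.prod_div_distrib, Finset.prod_const, Finset.card_range,
    ← Finset.prod_pow_eq_pow_sum, ← Finset.prod_inv_distrib]
  rfl

lemma muPer_of_le_walshWeight (hk : k ≠ 0) (hn : n ≤ walshWeight b k) :
    muPer b n k = ∑ i ∈ Finset.Icc 1 n, walshPos b k i := by
  rw [muPer, if_neg hk]
  split_ifs with h
  · rw [le_antisymm hn h, Nat.sub_self, zero_mul, add_zero]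
  · rfl

lemma prod_walshLength_div_eq_zpow_muPer (hk : k ≠ 0) (hn : n ≤ walshWeight b k) (m : ℝ) :
    ∏ i ∈ Finset.range n, walshLength b k i / m = (b : ℝ) ^ (-(muPer b n k : ℤ)) / m ^ n := by
  rw [prod_walshLength_div, muPer_of_le_walshWeight hk hn, zpow_neg, zpow_natCast]

lemma prod_walshLength_div_mul_pow_eq_zpow_muPer (hk : k ≠ 0) {w : ℕ}
    (hw : walshWeight b k = w + 1) (j : ℕ) (m : ℝ) :
    (∏ i ∈ Finset.range (w + 1), walshLength b k i / m) * (walshLength b k w / m) ^ j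
      = (b : ℝ) ^ (-(muPer b (w + 1 + j) k : ℤ)) / m ^ (w + 1 + j) := by
  rw [prod_walshLength_div, zpow_neg, zpow_natCast, muPer, if_neg hk, hw,
    if_pos (Nat.le_add_right _ _), Nat.add_sub_cancel_left, walshLength, div_pow, inv_pow,
    div_mul_div_comm, ← mul_inv, ← pow_mul, ← pow_add, ← pow_add, mul_comm j]

end WalshTower

section CoefficientBounds

variable {b k w n α : ℕ} {f : ℝ → ℝ}

lemma odd_of_not_modEq_two {m j : ℕ} (h : ¬ m + j ≡ m [MOD 2]) : Odd j := by
  rw [Nat.ModEq] at h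
  rw [Nat.odd_iff]
  omega

lemma StepTower.norm_integral_smul_iterPrim_le {𝕜 : Type*} [RCLike 𝕜] {L : ℕ → ℝ} {z : ℕ → 𝕜}
    (h : StepTower w L z) (hα : 0 < α)
    (hf : ∀ i < α, AbsolutelyContinuousOnInterval (derivUnit i f) 0 1) {K : ℝ}
    (hK : ∀ x, ‖iterPrim w L z α x‖ ≤ K) :
    ‖∫ x in (0 : ℝ)..1, f x • iterPrim w L z 0 x‖
      ≤ ∑ i ∈ Finset.Icc (w + 1) α, |∫ x in (0 : ℝ)..1, derivUnit i f x| * ‖iterPrim w L z i 0‖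
        + (∫ x in (0 : ℝ)..1, |derivUnit α f x|) * K := by
  have hint : IntervalIntegrable (derivUnit α f) volume 0 1 := by
    rw [← Nat.sub_add_cancel hα]
    exact intervalIntegrable_derivUnit_succ (hf (α - 1) (Nat.sub_lt hα one_pos))
  refine (norm_integral_smul_le_of_isPrimitive hf hint h.isPrimitive_iterPrim_succ
    (fun n => h.iterPrim_apply_one (n + 1)) hK).trans_eq ?_
  congr 1
  refine (Finset.sum_subset (Finset.Icc_subset_Icc_left (Nat.le_add_left 1 w))
    fun i hi hi' => ?_).symm
  rw [Finset.mem_Icc] at hi hi'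
  rw [h.iterPrim_apply_zero (by omega) (by omega), norm_zero, mul_zero]

lemma norm_iterPrim_walshRoot_add_le (hb : 2 < b) (hk : k ≠ 0) (hw : walshWeight b k = w + 1)
    (j : ℕ) (x : ℝ) :
    ‖iterPrim w (walshLength b k) (walshRoot b k) (w + 1 + j) x‖
      ≤ (b : ℝ) ^ (-(muPer b (w + 1 + j) k : ℤ)) / mMin b ^ (w + 1 + j)
        * (1 + walshConst b (w + 1)) := by
  have hT := stepTower_walshRoot hb.le hw
  have hB := towerBounds_walshRoot hb.le hw
  refine (hT.norm_iterPrim_add_le hB.pos (hB.le_norm w le_rfl) (fun x =>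
    (hT.norm_towerPrim_le hB le_rfl x).trans (mul_le_mul_of_nonneg_right
      (sum_mMax_div_pow_le hb w) (hT.prod_div_nonneg hB.pos le_rfl))) j x).trans_eq ?_
  rw [← prod_walshLength_div_mul_pow_eq_zpow_muPer hk hw]
  ring

lemma norm_iterPrim_walshRoot_le (hb : 2 < b) (hk : k ≠ 0) (hw : walshWeight b k = w + 1)
    (hn : 0 < n) (x : ℝ) :
    ‖iterPrim w (walshLength b k) (walshRoot b k) n x‖
      ≤ (b : ℝ) ^ (-(muPer b n k : ℤ)) / mMin b ^ n * (mMax b + walshConst b (w + 1)) := by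
  have hscale : 0 ≤ (b : ℝ) ^ (-(muPer b n k : ℤ)) / mMin b ^ n :=
    div_nonneg (zpow_nonneg b.cast_nonneg _) (pow_nonneg (mMin_pos hb.le).le _)
  rcases lt_or_ge w n with hwn | hnw
  · obtain ⟨j, rfl⟩ := Nat.exists_eq_add_of_le (Nat.succ_le_of_lt hwn)
    exact (norm_iterPrim_walshRoot_add_le hb hk hw j x).trans (mul_le_mul_of_nonneg_left
      (add_le_add_left (one_le_mMax hb.le) _) hscale)
  · obtain ⟨n, rfl⟩ := Nat.exists_eq_succ_of_ne_zero hn.ne'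
    rw [(stepTower_walshRoot hb.le hw).norm_iterPrim_of_le hnw]
    refine ((stepTower_walshRoot hb.le hw).norm_towerIntegral_succ_le
      (towerBounds_walshRoot hb.le hw) (by omega) x).trans ?_
    rw [prod_walshLength_div_eq_zpow_muPer hk (by omega), mul_comm]
    exact mul_le_mul_of_nonneg_left (add_le_add_right
      (mMax_div_mul_sum_le_walshConst hb (by omega)) _) hscale

lemma abs_iterPrim_walsh_two_add_le (hk : k ≠ 0) (hw : walshWeight 2 k = w + 1) (j : ℕ)
    (x : ℝ) :
    |iterPrim w (walshLength 2 k) (fun _ => (-1 : ℝ)) (w + 1 + j) x|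
      ≤ (2 : ℝ) ^ (-(muPer 2 (w + 1 + j) k : ℤ)) / 2 ^ (w + 1 + j) := by
  have hT := stepTower_walshLength_two hw
  refine (hT.norm_iterPrim_add_le two_pos (by norm_num)
    (hT.abs_towerPrim_neg_one_le le_rfl) j x).trans_eq ?_
  exact_mod_cast prod_walshLength_div_mul_pow_eq_zpow_muPer hk hw j 2

lemma abs_iterPrim_walsh_two_le (hk : k ≠ 0) (hw : walshWeight 2 k = w + 1) (hn : 0 < n) (x : ℝ) :
    |iterPrim w (walshLength 2 k) (fun _ => (-1 : ℝ)) n x|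
      ≤ (2 : ℝ) ^ (-(muPer 2 n k : ℤ)) / 2 ^ (n - 1) := by
  have hdouble : (2 : ℝ) ^ (-(muPer 2 n k : ℤ)) / 2 ^ (n - 1)
      = 2 * ((2 : ℝ) ^ (-(muPer 2 n k : ℤ)) / 2 ^ n) := by
    rw [← mul_pow_sub_one hn.ne' (2 : ℝ)]
    field_simp
  rw [hdouble]
  rcases lt_or_ge w n with hwn | hnw
  · obtain ⟨j, rfl⟩ := Nat.exists_eq_add_of_le (Nat.succ_le_of_lt hwn)
    exact (abs_iterPrim_walsh_two_add_le hk hw j x).trans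
      (le_mul_of_one_le_left (by positivity) one_le_two)
  · have hT := stepTower_walshLength_two hw
    have hscale := prod_walshLength_div_eq_zpow_muPer hk (hnw.trans (by omega)) (b := 2) 2
    rw [Nat.cast_ofNat] at hscale
    rw [← hscale, ← Real.norm_eq_abs, hT.norm_iterPrim_of_le hnw]
    exact hT.abs_towerIntegral_neg_one_le (by omega) x

end CoefficientBounds

theorem mainTheorem5_general (b : ℕ) [NeZero b] (α k : ℕ) (hα : 0 < α) (hk : 0 < k)
    (f : ℝ → ℝ) (hf : ∀ i < α, AbsolutelyContinuousOnInterval (derivUnit i f) 0 1) :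
    (2 < b →
      ‖walshCoeff b f k‖ ≤
        ∑ i ∈ Finset.Icc (walshWeight b k) α,
          |∫ x in (0 : ℝ)..1, derivUnit i f x|
            * ((b : ℝ) ^ (-(muPer b i k : ℤ)) / mMin b ^ i)
            * (1 + walshConst b (walshWeight b k))
        + (∫ x in (0 : ℝ)..1, |derivUnit α f x|)
            * ((b : ℝ) ^ (-(muPer b α k : ℤ)) / mMin b ^ α)
            * (mMax b + walshConst b (walshWeight b k))) ∧
    (b = 2 →
      ‖walshCoeff b f k‖ ≤
        ∑ i ∈ Finset.Icc (walshWeight b k) α with i ≡ walshWeight b k [MOD 2],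
          |∫ x in (0 : ℝ)..1, derivUnit i f x|
            * ((2 : ℝ) ^ (-(muPer b i k : ℤ)) / 2 ^ i)
        + (∫ x in (0 : ℝ)..1, |derivUnit α f x|)
            * ((2 : ℝ) ^ (-(muPer b α k : ℤ)) / 2 ^ (α - 1))) := by
  constructor
  · intro hb
    obtain ⟨w, hw⟩ := Nat.exists_eq_add_of_le' (walshWeight_pos (b := b) hk.ne')
    have hbound := (stepTower_walshRoot hb.le hw).norm_integral_smul_iterPrim_le hα hf
      (norm_iterPrim_walshRoot_le hb hk.ne' hw hα)
    rw [walshCoeff_eq_integral hw, hw]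
    simp only [mul_assoc]
    refine hbound.trans (add_le_add_left (Finset.sum_le_sum fun i hi => ?_) _)
    obtain ⟨j, rfl⟩ := Nat.exists_eq_add_of_le (Finset.mem_Icc.mp hi).1
    gcongr
    exact norm_iterPrim_walshRoot_add_le hb hk.ne' hw j 0
  · rintro rfl
    obtain ⟨w, hw⟩ := Nat.exists_eq_add_of_le' (walshWeight_pos (b := 2) hk.ne')
    have hT := stepTower_walshLength_two hw
    have hbound := hT.norm_integral_smul_iterPrim_le hα hf
      (abs_iterPrim_walsh_two_le hk.ne' hw hα)
    rw [walshCoeff_two_eq_integral hw, Complex.norm_real, hw, Finset.sum_filter]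
    refine hbound.trans (add_le_add_left (Finset.sum_le_sum fun i hi => ?_) _)
    obtain ⟨j, rfl⟩ := Nat.exists_eq_add_of_le (Finset.mem_Icc.mp hi).1
    split_ifs with hpar
    · gcongr
      exact abs_iterPrim_walsh_two_add_le hk.ne' hw j 0
    · rw [hT.iterPrim_neg_one_apply_zero_of_odd (odd_of_not_modEq_two hpar), norm_zero, mul_zero]

theorem mainTheorem5 (b : ℕ) [NeZero b] (hb : 2 ≤ b) (α k : ℕ) (hα : 0 < α) (hk : 0 < k)
    (f : ℝ → ℝ) (hf : MemSobolevUnit α f) :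
    (2 < b →
      ‖walshCoeff b f k‖ ≤
        ∑ i ∈ Finset.Icc (walshWeight b k) α,
          |∫ x in (0 : ℝ)..1, derivUnit i f x|
            * ((b : ℝ) ^ (-(muPer b i k : ℤ)) / mMin b ^ i)
            * (1 + walshConst b (walshWeight b k))
        + (∫ x in (0 : ℝ)..1, |derivUnit α f x|)
            * ((b : ℝ) ^ (-(muPer b α k : ℤ)) / mMin b ^ α)
            * (mMax b + walshConst b (walshWeight b k))) ∧
    (b = 2 →
      ‖walshCoeff b f k‖ ≤
        ∑ i ∈ Finset.Icc (walshWeight b k) α with i ≡ walshWeight b k [MOD 2],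
          |∫ x in (0 : ℝ)..1, derivUnit i f x|
            * ((2 : ℝ) ^ (-(muPer b i k : ℤ)) / 2 ^ i)
        + (∫ x in (0 : ℝ)..1, |derivUnit α f x|)
            * ((2 : ℝ) ^ (-(muPer b α k : ℤ)) / 2 ^ (α - 1))) :=
  mainTheorem5_general b α k hα hk f hf.absolutelyContinuous
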